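/- Let $c\ge 1$ be an integer and let $(b_j)_{j\ge 0}$ be real numbers with $b_j\ge 0$ for $j\ne 1$, $0<-b_1=\sum_{j\neq 1}b_j<\infty$, $b_0>0$ and $\sum_{j\ge 2}b_j>0$. The stopped $M^X/M/c$ queue is the continuous-time Markov chain $(X^*_t)_{t\ge 0}$ on $\{0,1,2,\dots\}$ with right-continuous paths and conservative bounded $q$-matrix $Q^*$ given, for $i\ge 1$, by $$q^*_{i,i-1}=\min(i,c)\,b_0,\qquad q^*_{ii}=b_1-[\min(i,c)-1]\,b_0,\qquad q^*_{ij}=b_{j-i+1}\ (j\ge i+1),$$ all other entries (in particular the whole row $i=0$) being $0$. Let $p^*_{ij}(t)$ be its transition function, $\tau^*_0=\inf\{t>0: X^*_t=0\}$ (with $\inf\emptyset=\infty$), $e^*_k=P(\tau^*_0<\infty\mid X^*_0=k)$ and $m^*_i(k)=\int_0^\infty p^*_{ki}(t)\,dt$. Put $B(s)=\sum_{j\ge0}b_js^j$ and $B_c(s)=B(s)+(c-1)b_0(1-s)$ for $s\in[0,1]$, and let $B_c'(1)=\sum_{j\ge 1}jb_j-(c-1)b_0\in(-\infty,\infty]$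 be its left derivative at $1$. **Theorem.** Let $k\ge 1$. Then $e^*_k=\lim_{t\to\infty}p^*_{k0}(t)$, and $m^*_i(k)<\infty$ for all $i\ge 1$. Moreover: (i) If $B_c'(1)\le 0$, then $e^*_k=1$. (ii) The equation $B_c(s)=0$ has a smallest root $u$ in $[0,1]$; $u=1$ if $B_c'(1)\le 0$ and $u<1$ if $B_c'(1)>0$. Whatever the sign of $B_c'(1)$ (in particular if $B_c'(1)>0$), $e=e^*_k$ and $m_i=m^*_i(k)$ $(1\le i\le c-1)$ form the unique real solution $(e,m_1,\dots,m_{c-1})$ of the linear system consisting of $$e=u^k-\sum_{i=1}^{c-1}m_i\,u^{i-1}(c-i)\,b_0(1-u),$$ of $b_0m_1=e$ (if $c\ge 2$), and, for $1\le j\le c-2$, of $$\sum_{i=1}^{j-1}b_{j-i+1}m_i+[b_1-(j-1)b_0]\,m_j+(j+1)b_0\,m_{j+1}=-\delta_{kj}.$$ Moreover, all the $m^*_i(k)$, $i\ge1$, are determined by $e^*_k$: they form the unique real sequence $(m_i)_{i\ge1}$ with $b_0m_1=e^*_k$ and, for every $j\ge 1$, $$\sum_{i=1}^{j-1}b_{j-i+1}m_i+[b_1-(\min(j,c)-1)b_0]\,m_j+\min(j+1,c)\,b_0\,m_{j+1}=-\delta_{kj}.$$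 (iii) The mean extinction time is $$E(\tau^*_0\mid X^*_0=k)=\begin{cases}-\dfrac{1}{B_c'(1)}\Big[k+\displaystyle\sum_{i=1}^{c-1}m^*_i(k)(c-i)b_0\Big] & \text{if } B_c'(1)<0,\\[2mm] \infty & \text{if } B_c'(1)\ge 0.\end{cases}$$ -/

import Mathlib

open Set Filter Topology MeasureTheory ProbabilityTheory
open scoped NNReal ENNReal

noncomputable section

namespace StoppedQueue

/-- The parameters `(b_j)` of the queue: `b_j ≥ 0` for `j ≠ 1`, `∑_{j ≠ 1} b_j = -b_1 < ∞`, and the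
nontriviality conditions `b_0 > 0` and `∑_{j ≥ 2} b_j > 0` (so that `-b_1 > 0`). -/
structure IsRateSequence (b : ℕ → ℝ) : Prop where
  nonneg : ∀ j, j ≠ 1 → 0 ≤ b j
  hasSum : HasSum (fun j => if j = 1 then 0 else b j) (-b 1)
  zero_pos : 0 < b 0
  tail_pos : 0 < ∑' j, b (j + 2)

/-- The `q`-matrix `Q*` of the stopped `M^X/M/c` queue. -/
def qStar (b : ℕ → ℝ) (c i j : ℕ) : ℝ :=
  if 1 ≤ i ∧ j + 1 = i then ((min i c : ℕ) : ℝ) * b 0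
  else if 1 ≤ i ∧ j = i then b 1 - (((min i c : ℕ) : ℝ) - 1) * b 0
  else if 1 ≤ i ∧ i + 1 ≤ j then b (j - i + 1)
  else 0

/-- The generating function `B(s) = ∑ b_j s^j`. -/
def genB (b : ℕ → ℝ) (s : ℝ) : ℝ := ∑' j, b j * s ^ j

/-- `B_i(s) = B(s) + (i - 1) b_0 (1 - s)`. -/
def genBi (b : ℕ → ℝ) (i : ℕ) (s : ℝ) : ℝ := genB b s + ((i : ℝ) - 1) * b 0 * (1 - s)

/-- `B_i'(1) = ∑ j b_j - (i - 1) b_0 ∈ (-∞, ∞]`, the (left) derivative of the power series `B_i`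
at its boundary point `1`; it equals `+∞` when `∑ j b_j` diverges. See `tendsto_slope_genBi`. -/
def genBiDerivOne (b : ℕ → ℝ) (i : ℕ) : EReal :=
  ((∑' j : ℕ, ENNReal.ofReal (if j = 1 then 0 else (j : ℝ) * b j) : ℝ≥0∞) : EReal)
    + ((b 1 - ((i : ℝ) - 1) * b 0 : ℝ) : EReal)

/-- Standard (possibly substochastic) transition functions on `ℕ`. -/
structure IsTransitionFunction (p : ℝ → ℕ → ℕ → ℝ) : Prop where
  nonneg : ∀ t, 0 ≤ t → ∀ i j, 0 ≤ p t i j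
  summable : ∀ t, 0 ≤ t → ∀ i, Summable (p t i)
  sum_le_one : ∀ t, 0 ≤ t → ∀ i, ∑' j, p t i j ≤ 1
  zero : ∀ i j, p 0 i j = if i = j then 1 else 0
  chapman_kolmogorov : ∀ s t, 0 ≤ s → 0 ≤ t → ∀ i j,
    HasSum (fun l => p s i l * p t l j) (p (s + t) i j)
  standard : ∀ i j, Tendsto (fun t => p t i j) (𝓝[>] 0) (𝓝 (if i = j then 1 else 0))

/-- `p` is a `Q`-function: a standard transition function with `p'(0) = Q` (right derivative at
`0`, entry by entry). -/
structure IsQFunction (q : ℕ → ℕ → ℝ) (p : ℝ → ℕ → ℕ → ℝ) : Prop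
    extends IsTransitionFunction p where
  deriv_zero : ∀ i j, HasDerivWithinAt (fun t => p t i j) (q i j) (Ici 0) 0

/-- `X` is a continuous-time Markov chain on `ℕ` under the probability `P`, with transition function
`p`, an arbitrary initial law, and almost surely right-continuous paths (`ℕ` being discrete). -/
structure IsMarkovChain {Ω : Type*} [MeasurableSpace Ω] (p : ℝ → ℕ → ℕ → ℝ)
    (X : ℝ≥0 → Ω → ℕ) (P : Measure Ω) : Prop where
  measurable : ∀ t, Measurable (X t)
  rightCts : ∀ᵐ ω ∂P, ∀ t, ContinuousWithinAt (fun r => X r ω) (Ici t) t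
  law : ∀ (n : ℕ) (t : ℕ → ℝ≥0), Monotone t → t 0 = 0 → ∀ x : ℕ → ℕ,
    P {ω | ∀ l ≤ n, X (t l) ω = x l} =
      P {ω | X 0 ω = x 0} *
        ∏ l ∈ Finset.range n,
          ENNReal.ofReal (p ((t (l + 1) : ℝ) - (t l : ℝ)) (x l) (x (l + 1)))

/-- The extinction time `inf {t > 0 | X_t = 0}`, equal to `∞` if there is no such `t`. -/
def extinctionTime {Ω : Type*} (X : ℝ≥0 → Ω → ℕ) (ω : Ω) : ℝ≥0∞ :=
  ⨅ (t : ℝ≥0) (_ : 0 < t ∧ X t ω = 0), (t : ℝ≥0∞)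

/-- `e*_k = P(τ < ∞ | X_0 = k)`. -/
def extinctionProb {Ω : Type*} [MeasurableSpace Ω] (X : ℝ≥0 → Ω → ℕ) (P : Measure Ω) (k : ℕ) : ℝ :=
  (P[|{ω | X 0 ω = k}] {ω | extinctionTime X ω < ∞}).toReal

/-- `E(τ | X_0 = k) ∈ [0, ∞]`. -/
def meanExtinctionTime {Ω : Type*} [MeasurableSpace Ω] (X : ℝ≥0 → Ω → ℕ) (P : Measure Ω)
    (k : ℕ) : ℝ≥0∞ :=
  ∫⁻ ω, extinctionTime X ω ∂(P[|{ω | X 0 ω = k}])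

/-- The expected occupation time `m*_i(k) = ∫_0^∞ p_{ki}(t) dt`. -/
def occupationTime (p : ℝ → ℕ → ℕ → ℝ) (k i : ℕ) : ℝ := ∫ t in Ioi (0 : ℝ), p t k i

/-- The linear system for the `c` unknowns `e` and `m 1, …, m (c - 1)`: one equation if `c = 1`, and
`c` equations in general. No other value of `m` occurs in it. -/
structure ExtinctionSystem (b : ℕ → ℝ) (c k : ℕ) (u e : ℝ) (m : ℕ → ℝ) : Prop where
  root : e = u ^ k -
    ∑ i ∈ Finset.Icc 1 (c - 1), m i * u ^ (i - 1) * ((c : ℝ) - (i : ℝ)) * b 0 * (1 - u)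
  absorb : 2 ≤ c → b 0 * m 1 = e
  balance : ∀ j, 1 ≤ j → j + 2 ≤ c →
    ∑ i ∈ Finset.Icc 1 (j - 1), b (j - i + 1) * m i + (b 1 - ((j : ℝ) - 1) * b 0) * m j
      + ((j : ℝ) + 1) * b 0 * m (j + 1) = -(if k = j then 1 else 0)

/-- The recursion that continues the system to all `m i`, `i ≥ 1`: it is
`∑_{i ≥ 1} m_i q*_{ij} = -δ_{kj}` for every `j ≥ 1`, together with `b_0 m_1 = e`. -/
structure OccupationRecursion (b : ℕ → ℝ) (c k : ℕ) (e : ℝ) (m : ℕ → ℝ) : Prop where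
  absorb : b 0 * m 1 = e
  balance : ∀ j, 1 ≤ j →
    ∑ i ∈ Finset.Icc 1 (j - 1), b (j - i + 1) * m i
      + (b 1 - (((min j c : ℕ) : ℝ) - 1) * b 0) * m j
      + ((min (j + 1) c : ℕ) : ℝ) * b 0 * m (j + 1) = -(if k = j then 1 else 0)

/-- `genBiDerivOne b i` is the left derivative at `1` of the function `B_i` (in `(-∞, ∞]`). -/
theorem tendsto_slope_genBi {b : ℕ → ℝ} (hb : IsRateSequence b) (i : ℕ) :
    Tendsto (fun s : ℝ => ((slope (genBi b i) 1 s : ℝ) : EReal)) (𝓝[<] 1)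
      (𝓝 (genBiDerivOne b i)) := by
  set a : ℕ → ℝ := fun j => if j = 1 then 0 else b j with ha
  have ha0 : ∀ j, 0 ≤ a j := by
    intro j
    by_cases h : j = 1
    · simp [ha, h]
    · simpa [ha, h] using hb.nonneg j h
  have hS : Summable a := hb.hasSum.summable
  -- the finite geometric sums
  let g : ℕ → ℝ → ℝ := fun j s => a j * ∑ l ∈ Finset.range j, s ^ l
  have hg0 : ∀ j s, 0 ≤ s → 0 ≤ g j s := fun j s hs =>
    mul_nonneg (ha0 j) (Finset.sum_nonneg fun l _ => pow_nonneg hs l)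
  have hg1 : ∀ j, g j 1 = if j = 1 then 0 else (j : ℝ) * b j := by
    intro j
    by_cases h : j = 1 <;> simp [g, ha, h, mul_comm]
  have hgle : ∀ j s, 0 ≤ s → s ≤ 1 → g j s ≤ g j 1 := by
    intro j s hs hs1
    refine mul_le_mul_of_nonneg_left (Finset.sum_le_sum fun l _ => ?_) (ha0 j)
    simpa using pow_le_one₀ hs hs1
  have hev : ∀ᶠ s : ℝ in 𝓝[<] 1, s ∈ Ioo (0 : ℝ) 1 := Ioo_mem_nhdsLT one_pos
  have hT : Tendsto (fun s : ℝ => ∑' j, ENNReal.ofReal (g j s)) (𝓝[<] 1)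
      (𝓝 (∑' j, ENNReal.ofReal (g j 1))) := by
    refine tendsto_order.2 ⟨fun x hx => ?_, fun x hx => ?_⟩
    · rw [ENNReal.tsum_eq_iSup_sum, lt_iSup_iff] at hx
      obtain ⟨F, hF⟩ := hx
      have hc : Continuous (fun s : ℝ => ∑ j ∈ F, ENNReal.ofReal (g j s)) := by
        refine continuous_finsetSum _ fun j _ => ENNReal.continuous_ofReal.comp ?_
        fun_prop
      have := (hc.tendsto 1).mono_left (nhdsWithin_le_nhds (s := Iio 1))
      filter_upwards [(tendsto_order.1 this).1 x hF] with s hs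
      exact hs.trans_le (ENNReal.sum_le_tsum F)
    · filter_upwards [hev] with s hs
      exact lt_of_le_of_lt (ENNReal.tsum_le_tsum fun j =>
        ENNReal.ofReal_le_ofReal (hgle j s hs.1.le hs.2.le)) hx
  have hT' := ((continuous_coe_ennreal_ereal.tendsto _).comp hT)
  have hadd : Tendsto (fun s : ℝ => ((∑' j, ENNReal.ofReal (g j s) : ℝ≥0∞) : EReal)
      + ((b 1 - ((i : ℝ) - 1) * b 0 : ℝ) : EReal)) (𝓝[<] 1) (𝓝 (genBiDerivOne b i)) := by
    have hcont := EReal.continuousAt_add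
      (p := (((∑' j, ENNReal.ofReal (g j 1) : ℝ≥0∞) : EReal),
        ((b 1 - ((i : ℝ) - 1) * b 0 : ℝ) : EReal)))
      (Or.inr (EReal.coe_ne_bot _)) (Or.inr (EReal.coe_ne_top _))
    have h2 := hcont.tendsto.comp (hT'.prodMk_nhds
      (tendsto_const_nhds (x := ((b 1 - ((i : ℝ) - 1) * b 0 : ℝ) : EReal))))
    have e1 : genBiDerivOne b i = ((∑' j, ENNReal.ofReal (g j 1) : ℝ≥0∞) : EReal)
        + ((b 1 - ((i : ℝ) - 1) * b 0 : ℝ) : EReal) := by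
      simp only [genBiDerivOne, hg1]
    rw [e1]
    exact h2
  refine hadd.congr' ?_
  filter_upwards [hev] with s hs
  have hne : s - 1 ≠ 0 := by linarith [hs.2]
  have hgeo : ∀ j, a j * s ^ j - a j = (s - 1) * g j s := by
    intro j
    have := geom_sum_mul s j
    simp only [g]
    linear_combination (-a j) * this
  have hSs : Summable (fun j => a j * s ^ j) :=
    Summable.of_nonneg_of_le (fun j => mul_nonneg (ha0 j) (pow_nonneg hs.1.le j))
      (fun j => mul_le_of_le_one_right (ha0 j) (pow_le_one₀ hs.1.le hs.2.le)) hS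
  have hgS : Summable (fun j => g j s) := by
    have := (hSs.sub hS).mul_left (s - 1)⁻¹
    refine this.congr fun j => ?_
    rw [hgeo j]
    field_simp
  have hsplit : ∀ r : ℝ, Summable (fun j => a j * r ^ j) →
      genB b r = ∑' j, a j * r ^ j + b 1 * r := by
    intro r hr
    have h1 : HasSum (fun j => if j = 1 then b 1 * r else 0) (b 1 * r) := hasSum_ite_eq 1 _
    refine (HasSum.congr_fun (hr.hasSum.add h1) fun j => ?_).tsum_eq
    by_cases h : j = 1 <;> simp [ha, h]
  have hd : ∑' j, a j * s ^ j - ∑' j, a j = (s - 1) * ∑' j, g j s := by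
    rw [← hSs.tsum_sub hS, ← tsum_mul_left]
    exact tsum_congr hgeo
  have hslope : slope (genBi b i) 1 s = ∑' j, g j s + (b 1 - ((i : ℝ) - 1) * b 0) := by
    rw [slope_def_field, div_eq_iff hne]
    simp only [genBi]
    rw [hsplit s hSs, hsplit 1 (by simpa using hS)]
    simp only [one_pow, mul_one]
    linear_combination hd
  rw [hslope, ← ENNReal.ofReal_tsum_of_nonneg (fun j => hg0 j s hs.1.le) hgS,
    EReal.coe_ennreal_ofReal, max_eq_left (tsum_nonneg fun j => hg0 j s hs.1.le), EReal.coe_add]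

end StoppedQueue

end

noncomputable section

namespace StoppedQueue

/-! ### Transition functions with bounded `q`-matrix -/

namespace IsTransitionFunction

variable {p : ℝ → ℕ → ℕ → ℝ}

/-! Let `M_i(t)` be the expected time spent in `i` up to time `t`, starting from `k`. The `q`-matrix
is bounded, so the forward equation holds; integrated over `[0, t]` it says `∑_l M_l(t) q*_{lj} =
p_{kj}(t) - δ_{kj}`. The chain steps down by at most one, so column `j` involves only `l ≤ j + 1`.
Solving the columns successively for `M_{j+1}(t)` bounds each `M_i(t)`, `i ≥ 1`, uniformly in `t`
(`exists_occupationTimeUpTo_le`). Hence the `m_i` are finite, `p_{kj}(t) → 0` for `j ≥ 1`,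
`p_{k0}(t) → e := b_0 m_1`, and the recursion is the limit of the columns.

For `s < 1` the columns combine into a generating function identity. As `t → ∞` its right side tends
to `N(s) = e - s^k + (1-s) b_0 ∑_{i<c} (c-i) m_i s^(i-1)`, while its left side is `B_c(s) ∑
M_{i+1}(t) s^i`. At a root `u < 1` this gives `N(u) = 0`, the first equation of the system. If
`B_c'(1) ≤ 0`, then `B_c > 0` on `[0, 1)`, so `N ≥ 0` there and `s → 1` yields `e = 1`. Dividing by
`1 - s` before letting `s → 1` then yields `∑ m_i`, or its divergence when `B_c'(1) = 0`.

The finite system has only one solution because two monotonicities oppose each other: the balance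
equations make `m_1, …, m_{c-1}` nondecreasing in `e` (by nonnegative flows across levels,
`flow_across_level`), and the root equation makes `e` nonincreasing in the `m_i`.

On the probabilistic side, `0` is almost surely absorbing. So `{τ < ∞}` is, up to null sets, the
limit of `{X_n = 0}`, and `E τ = ∫ P(X_t ≠ 0) dt = ∑ m_i` when `τ` is almost surely finite. -/

theorem sum_le_one_finset (hp : IsTransitionFunction p) {t : ℝ} (ht : 0 ≤ t) (i : ℕ)
    (F : Finset ℕ) : ∑ j ∈ F, p t i j ≤ 1 :=
  ((hp.summable t ht i).sum_le_tsum F fun j _ => hp.nonneg t ht i j).trans (hp.sum_le_one t ht i)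

theorem le_one (hp : IsTransitionFunction p) {t : ℝ} (ht : 0 ≤ t) (i j : ℕ) : p t i j ≤ 1 := by
  simpa using hp.sum_le_one_finset ht i {j}

theorem le_one_sub_diag (hp : IsTransitionFunction p) {t : ℝ} (ht : 0 ≤ t) {i j : ℕ}
    (hij : i ≠ j) : p t i j ≤ 1 - p t i i := by
  have := hp.sum_le_one_finset ht i {i, j}
  rw [Finset.sum_pair hij] at this
  linarith

theorem mul_le (hp : IsTransitionFunction p) {s t : ℝ} (hs : 0 ≤ s) (ht : 0 ≤ t) (i l j : ℕ) :
    p s i l * p t l j ≤ p (s + t) i j := by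
  have h := hp.chapman_kolmogorov s t hs ht i j
  exact le_hasSum h l fun m _ => mul_nonneg (hp.nonneg s hs i m) (hp.nonneg t ht m j)

theorem diag_pow_le (hp : IsTransitionFunction p) {t : ℝ} (ht : 0 ≤ t) (i n : ℕ) :
    p t i i ^ n ≤ p (n * t) i i := by
  induction n with
  | zero => simp [hp.zero]
  | succ n ih =>
    have h0 := hp.nonneg t ht i i
    calc p t i i ^ (n + 1) = p t i i ^ n * p t i i := pow_succ _ _
      _ ≤ p (n * t) i i * p t i i := mul_le_mul_of_nonneg_right ih h0
      _ ≤ p (n * t + t) i i := hp.mul_le (by positivity) ht i i i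
      _ = p ((n + 1 : ℕ) * t) i i := by push_cast; ring_nf

end IsTransitionFunction

namespace IsQFunction

variable {q : ℕ → ℕ → ℝ} {p : ℝ → ℕ → ℕ → ℝ}

theorem tendsto_slope (hp : IsQFunction q p) (i j : ℕ) :
    Tendsto (fun h => (p h i j - if i = j then 1 else 0) / h) (𝓝[>] 0) (𝓝 (q i j)) := by
  have h := (hasDerivWithinAt_iff_tendsto_slope.1 (hp.deriv_zero i j))
  have hset : Ici (0 : ℝ) \ {0} = Ioi 0 := by
    ext x; simp [lt_iff_le_and_ne, eq_comm]
  rw [hset] at h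
  refine h.congr fun t => ?_
  rw [slope_def_field, hp.zero, sub_zero]

/-- The holding time in `i` is exponential with parameter `-q i i`. -/
theorem exp_le_diag (hp : IsQFunction q p) (i : ℕ) {t : ℝ} (ht : 0 ≤ t) :
    Real.exp (q i i * t) ≤ p t i i := by
  rcases ht.eq_or_lt with rfl | ht
  · simp [hp.zero]
  have hseq : Tendsto (fun n : ℕ => t / n) atTop (𝓝[>] 0) := by
    refine tendsto_nhdsWithin_iff.2 ⟨tendsto_const_div_atTop_nhds_zero_nat t, ?_⟩
    filter_upwards [eventually_gt_atTop 0] with n hn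
    have : (0 : ℝ) < n := by exact_mod_cast hn
    exact div_pos ht this
  have h1 : Tendsto (fun n : ℕ => (n : ℝ) * (p (t / n) i i - 1)) atTop (𝓝 (q i i * t)) := by
    have := ((hp.tendsto_slope i i).comp hseq).mul_const t
    refine this.congr' ?_
    filter_upwards [eventually_gt_atTop 0] with n hn
    have : (0 : ℝ) < n := by exact_mod_cast hn
    simp only [Function.comp, if_true]
    field_simp
  -- Being in `i` at all multiples of `t / n` has probability `p(t/n)^n ≤ p(t)`, and `p(t/n)^n`
  -- tends to the exponential.
  refine le_of_tendsto (Real.tendsto_one_add_pow_exp_of_tendsto h1) ?_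
  filter_upwards [eventually_gt_atTop 0] with n hn
  have hn' : (0 : ℝ) < n := by exact_mod_cast hn
  have := hp.diag_pow_le (t := t / n) (by positivity) i n
  rwa [mul_div_cancel₀ _ hn'.ne', ← add_sub_cancel 1 (p (t / n) i i)] at this

theorem one_sub_diag_le (hp : IsQFunction q p) {K : ℝ} (hK : ∀ i, -K ≤ q i i) (i : ℕ) {t : ℝ}
    (ht : 0 ≤ t) : 1 - p t i i ≤ K * t := by
  have h1 := hp.exp_le_diag i ht
  have h2 := Real.add_one_le_exp (q i i * t)
  nlinarith [mul_le_mul_of_nonneg_right (hK i) ht]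

/-- The bound is uniform in `i` and `j`: an off-diagonal entry is at most the mass missing from the
diagonal. This uniformity supplies both the Lipschitz continuity and the domination behind the
forward equation. -/
theorem abs_sub_le (hp : IsQFunction q p) {K : ℝ} (hK : ∀ i, -K ≤ q i i) (i j : ℕ) {t : ℝ}
    (ht : 0 ≤ t) : |p t i j - if i = j then 1 else 0| ≤ K * t := by
  have h1 := hp.one_sub_diag_le hK i ht
  split_ifs with h
  · subst h
    rw [abs_sub_comm, abs_of_nonneg (by linarith [hp.le_one ht i i])]
    exact h1
  · rw [sub_zero, abs_of_nonneg (hp.nonneg t ht i j)]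
    exact (hp.le_one_sub_diag ht h).trans h1

theorem hasSum_increment (hp : IsQFunction q p) {s t : ℝ} (hs : 0 ≤ s) (ht : 0 ≤ t) (i j : ℕ) :
    HasSum (fun l => p s i l * (p t l j - if l = j then 1 else 0)) (p (s + t) i j - p s i j) := by
  have h1 := hp.chapman_kolmogorov s t hs ht i j
  have h2 : HasSum (fun l => if l = j then p s i j else 0) (p s i j) := hasSum_ite_eq j _
  refine (h1.sub h2).congr_fun fun l => ?_
  by_cases h : l = j
  · subst h; simp [mul_sub]
  · simp [h]

theorem abs_increment_le (hp : IsQFunction q p) {K : ℝ} (hK : ∀ i, -K ≤ q i i) {s t : ℝ}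
    (hs : 0 ≤ s) (ht : 0 ≤ t) (i j : ℕ) : |p (s + t) i j - p s i j| ≤ K * t := by
  have hKt : 0 ≤ K * t := (abs_nonneg _).trans (hp.abs_sub_le hK i i ht)
  have hb : HasSum (fun l => p s i l * (K * t)) ((∑' l, p s i l) * (K * t)) :=
    (hp.summable s hs i).hasSum.mul_right _
  have h := hp.hasSum_increment hs ht i j
  have h3 : ∀ l, |p s i l * (p t l j - if l = j then 1 else 0)| ≤ p s i l * (K * t) := fun l => by
    rw [abs_mul, abs_of_nonneg (hp.nonneg s hs i l)]
    exact mul_le_mul_of_nonneg_left (hp.abs_sub_le hK l j ht) (hp.nonneg s hs i l)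
  have h4 := tsum_of_norm_bounded (f := fun l => p s i l * (p t l j - if l = j then 1 else 0)) hb h3
  rw [h.tsum_eq] at h4
  exact h4.trans (mul_le_of_le_one_left hKt (hp.sum_le_one s hs i))

theorem continuousOn (hp : IsQFunction q p) {K : ℝ} (hK : ∀ i, -K ≤ q i i) (i j : ℕ) :
    ContinuousOn (fun t => p t i j) (Ici 0) := by
  have hK0 : 0 ≤ K := by
    have := (abs_nonneg _).trans (hp.abs_sub_le hK 0 0 zero_le_one)
    linarith
  refine (LipschitzOnWith.of_dist_le_mul (K := ⟨K, hK0⟩) ?_).continuousOn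
  have key : ∀ s t : ℝ, 0 ≤ s → s ≤ t → dist (p s i j) (p t i j) ≤ K * dist s t := by
    intro s t hs hst
    rw [dist_comm, dist_comm s, Real.dist_eq, Real.dist_eq, abs_of_nonneg (sub_nonneg.2 hst)]
    simpa using hp.abs_increment_le hK hs (sub_nonneg.2 hst) i j
  intro s hs t ht
  rcases le_total s t with h | h
  · exact key s t hs h
  · rw [dist_comm, dist_comm s]
    exact key t s ht h

/-- The forward equation. -/
theorem hasDerivWithinAt (hp : IsQFunction q p) {K : ℝ} (hK : ∀ i, -K ≤ q i i) (i j : ℕ) {t : ℝ}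
    (ht : 0 ≤ t) :
    HasDerivWithinAt (fun t => p t i j) (∑' l, p t i l * q l j) (Ioi t) t := by
  rw [hasDerivWithinAt_iff_tendsto_slope' self_notMem_Ioi]
  have hsub : Tendsto (fun r => r - t) (𝓝[>] t) (𝓝[>] 0) := by
    refine tendsto_nhdsWithin_iff.2 ⟨?_, ?_⟩
    · have : Tendsto (fun r => r - t) (𝓝 t) (𝓝 (t - t)) := tendsto_id.sub_const t
      rw [sub_self] at this
      exact this.mono_left nhdsWithin_le_nhds
    · filter_upwards [self_mem_nhdsWithin] with r hr
      exact sub_pos.2 (mem_Ioi.1 hr)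
  have hlim : Tendsto (fun h => ∑' l, p t i l * ((p h l j - if l = j then 1 else 0) / h)) (𝓝[>] 0)
      (𝓝 (∑' l, p t i l * q l j)) := by
    refine tendsto_tsum_of_dominated_convergence (bound := fun l => p t i l * K)
      ((hp.summable t ht i).mul_right K) (fun l => (hp.tendsto_slope l j).const_mul _) ?_
    filter_upwards [self_mem_nhdsWithin] with h hh l
    have hh : 0 < h := hh
    rw [norm_mul, Real.norm_of_nonneg (hp.nonneg t ht i l), Real.norm_eq_abs, abs_div,
      abs_of_pos hh]
    exact mul_le_mul_of_nonneg_left ((div_le_iff₀ hh).2 (hp.abs_sub_le hK l j hh.le))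
      (hp.nonneg t ht i l)
  refine (hlim.comp hsub).congr' ?_
  filter_upwards [self_mem_nhdsWithin] with r hr
  have hr : t < r := hr
  have h := (hp.hasSum_increment ht (sub_nonneg.2 hr.le) i j).div_const (r - t)
  rw [add_sub_cancel] at h
  rw [slope_def_field, ← h.tsum_eq]
  exact tsum_congr fun l => by simp only [mul_div_assoc]

/-- A right derivative suffices for the fundamental theorem, as `p` is continuous. Finite support of
the column avoids interchanging a series with the integral. -/
theorem forward_integral (hp : IsQFunction q p) {K : ℝ} (hK : ∀ i, -K ≤ q i i) (i j : ℕ)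
    {F : Finset ℕ} (hF : ∀ l, l ∉ F → q l j = 0) {t : ℝ} (ht : 0 ≤ t) :
    ∑ l ∈ F, (∫ r in (0 : ℝ)..t, p r i l) * q l j = p t i j - if i = j then 1 else 0 := by
  have hsum : ∀ r, ∑' l, p r i l * q l j = ∑ l ∈ F, p r i l * q l j := fun r =>
    tsum_eq_sum fun l hl => by rw [hF l hl, mul_zero]
  have hint : ∀ l, IntervalIntegrable (fun r => p r i l) volume 0 t := fun l =>
    ((hp.continuousOn hK i l).mono fun x hx => by
      rw [uIcc_of_le ht] at hx; exact hx.1).intervalIntegrable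
  have hsumint : IntervalIntegrable (fun r => ∑ l ∈ F, p r i l * q l j) volume 0 t := by
    have h := IntervalIntegrable.sum F fun l _ => (hint l).mul_const (q l j)
    rwa [show (∑ l ∈ F, fun r => p r i l * q l j) = fun r => ∑ l ∈ F, p r i l * q l j by
      ext r; simp] at h
  have h := intervalIntegral.integral_eq_sub_of_hasDeriv_right_of_le ht
    (f := fun r => p r i j) (f' := fun r => ∑ l ∈ F, p r i l * q l j)
    ((hp.continuousOn hK i j).mono Icc_subset_Ici_self)
    (fun r hr => by
      rw [← hsum]
      exact hp.hasDerivWithinAt hK i j hr.1.le)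
    hsumint
  rw [intervalIntegral.integral_finsetSum fun l _ => (hint l).mul_const _, hp.zero] at h
  rw [← h]
  exact Finset.sum_congr rfl fun l _ => (intervalIntegral.integral_mul_const _ _).symm

end IsQFunction

section QMatrix

/-! ### The `q`-matrix of the stopped queue -/

variable {b : ℕ → ℝ} {c : ℕ}

theorem IsRateSequence.one_nonpos (hb : IsRateSequence b) : b 1 ≤ 0 := by
  have := hb.hasSum.nonneg fun j => by
    split_ifs with h
    exacts [le_rfl, hb.nonneg j h]
  linarith

theorem qStar_zero_left (j : ℕ) : qStar b c 0 j = 0 := by simp [qStar]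

theorem qStar_eq_zero {i j : ℕ} (h : j + 2 ≤ i) : qStar b c i j = 0 := by
  unfold qStar
  rw [if_neg (by omega), if_neg (by omega), if_neg (by omega)]

theorem qStar_diag {i : ℕ} (hi : 1 ≤ i) :
    qStar b c i i = b 1 - (((min i c : ℕ) : ℝ) - 1) * b 0 := by
  unfold qStar
  rw [if_neg (by omega), if_pos ⟨hi, rfl⟩]

theorem qStar_succ_left (j : ℕ) : qStar b c (j + 1) j = ((min (j + 1) c : ℕ) : ℝ) * b 0 := by
  unfold qStar
  rw [if_pos ⟨by omega, rfl⟩]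

theorem qStar_of_lt {i j : ℕ} (hi : 1 ≤ i) (hij : i < j) : qStar b c i j = b (j - i + 1) := by
  unfold qStar
  rw [if_neg (by omega), if_neg (by omega), if_pos ⟨hi, hij⟩]

theorem neg_le_qStar_diag (hc : 1 ≤ c) (hb : IsRateSequence b) (i : ℕ) :
    -(-b 1 + ((c : ℝ) - 1) * b 0) ≤ qStar b c i i := by
  have h1 := hb.one_nonpos
  have h0 := hb.zero_pos
  have hc' : (1 : ℝ) ≤ c := by exact_mod_cast hc
  rcases Nat.eq_zero_or_pos i with rfl | hi
  · rw [qStar_zero_left]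
    nlinarith
  · rw [qStar_diag hi]
    have : ((min i c : ℕ) : ℝ) ≤ c := by exact_mod_cast min_le_right i c
    nlinarith

/-- The rows of `Q*` are those of a random walk, corrected by `min(i, c) - 1` additional servers. -/
theorem qStar_succ_eq (i j : ℕ) : qStar b c (i + 1) j = (if i ≤ j then b (j - i) else 0) +
    (((min (i + 1) c : ℕ) : ℝ) - 1) * b 0 *
      ((if i = j then 1 else 0) - if i + 1 = j then 1 else 0) := by
  rcases lt_trichotomy (i + 1) j with h | h | h
  · rw [qStar_of_lt (by omega) h, if_pos (by omega), if_neg (by omega), if_neg (by omega)]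
    rw [show j - (i + 1) + 1 = j - i by omega]
    ring
  · subst h
    rw [qStar_diag (by omega), if_pos (by omega), if_neg (by omega), if_pos rfl]
    rw [show i + 1 - i = 1 by omega]
    ring
  · rcases eq_or_ne i j with rfl | h'
    · rw [qStar_succ_left, if_pos le_rfl, if_pos rfl, if_neg (by omega), Nat.sub_self]
      ring
    · rw [qStar_eq_zero (by omega), if_neg (by omega), if_neg h', if_neg (by omega)]
      ring

theorem sum_mul_qStar_zero (hc : 1 ≤ c) (w : ℕ → ℝ) :
    ∑ l ∈ Finset.range 2, w l * qStar b c l 0 = b 0 * w 1 := by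
  have h1 := qStar_succ_left (b := b) (c := c) 0
  rw [Finset.sum_range_succ, Finset.sum_range_one, qStar_zero_left, h1, zero_add,
    Nat.min_eq_left hc]
  push_cast
  ring

theorem sum_mul_qStar (w : ℕ → ℝ) {j : ℕ} (hj : 1 ≤ j) :
    ∑ l ∈ Finset.range (j + 2), w l * qStar b c l j =
      ∑ i ∈ Finset.Icc 1 (j - 1), b (j - i + 1) * w i
        + (b 1 - (((min j c : ℕ) : ℝ) - 1) * b 0) * w j
        + ((min (j + 1) c : ℕ) : ℝ) * b 0 * w (j + 1) := by
  rw [Finset.sum_range_succ, Finset.sum_range_succ, qStar_diag hj, qStar_succ_left,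
    mul_comm (w j), mul_comm (w (j + 1))]
  congr 2
  symm
  refine (Finset.sum_congr rfl fun i hi => ?_).trans
    (Finset.sum_subset (f := fun l => w l * qStar b c l j) (fun i hi => ?_) fun i hi hi' => ?_)
  · rw [Finset.mem_Icc] at hi
    rw [qStar_of_lt hi.1 (by omega), mul_comm]
  · rw [Finset.mem_Icc] at hi
    rw [Finset.mem_range]
    omega
  · rw [Finset.mem_Icc] at hi'
    rw [Finset.mem_range] at hi
    have : i = 0 := by omega
    rw [this, qStar_zero_left, mul_zero]

/-! ### Generating functions -/

theorem IsRateSequence.summable_abs (hb : IsRateSequence b) : Summable fun j => |b j| := by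
  have h1 : HasSum (fun j => if j = 1 then |b 1| else 0) |b 1| := hasSum_ite_eq 1 _
  refine (hb.hasSum.add h1).summable.congr fun j => ?_
  by_cases h : j = 1
  · simp [h]
  · simp [h, abs_of_nonneg (hb.nonneg j h)]

theorem IsRateSequence.abs_mul_pow_le {s : ℝ} (hs : s ∈ Icc (0 : ℝ) 1) (j : ℕ) :
    ‖b j * s ^ j‖ ≤ |b j| := by
  rw [norm_mul, Real.norm_eq_abs, norm_pow, Real.norm_of_nonneg hs.1]
  exact mul_le_of_le_one_right (abs_nonneg _) (pow_le_one₀ hs.1 hs.2)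

theorem IsRateSequence.summable_norm_mul_pow (hb : IsRateSequence b) {s : ℝ}
    (hs : s ∈ Icc (0 : ℝ) 1) : Summable fun j => ‖b j * s ^ j‖ :=
  hb.summable_abs.of_nonneg_of_le (fun _ => norm_nonneg _) fun j =>
    IsRateSequence.abs_mul_pow_le hs j

/-- The generating function of the measure `w Q*`. -/
theorem hasSum_sum_mul_qStar_mul_pow (hb : IsRateSequence b) {w : ℕ → ℝ}
    {s : ℝ} (hs : s ∈ Icc (0 : ℝ) 1) (hw : Summable fun i => ‖w (i + 1) * s ^ i‖) :
    HasSum (fun j => (∑ l ∈ Finset.range (j + 2), w l * qStar b c l j) * s ^ j)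
      (genBi b c s * ∑' i, w (i + 1) * s ^ i -
        (1 - s) * b 0 * ∑ i ∈ Finset.Icc 1 (c - 1), w i * s ^ (i - 1) * ((c : ℝ) - i)) := by
  -- The random walk part of each row is a convolution, handled by a Cauchy product; the extra
  -- servers are the sequence `v`.
  have hbs := hb.summable_norm_mul_pow hs
  have hprod := (summable_norm_sum_mul_range_of_summable_norm hw hbs).of_norm.hasSum
  rw [← tsum_mul_tsum_eq_tsum_sum_range_of_summable_norm hw hbs] at hprod
  set v : ℕ → ℝ := fun i => (((min (i + 1) c : ℕ) : ℝ) - 1) * b 0 * w (i + 1) with hv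
  -- the missing servers
  have hfin : HasSum (fun i => ((c : ℝ) - ((min (i + 1) c : ℕ) : ℝ)) * b 0 * (w (i + 1) * s ^ i))
      (b 0 * ∑ i ∈ Finset.Icc 1 (c - 1), w i * s ^ (i - 1) * ((c : ℝ) - i)) := by
    have hs0 : ∀ i ∉ Finset.range (c - 1),
        ((c : ℝ) - ((min (i + 1) c : ℕ) : ℝ)) * b 0 * (w (i + 1) * s ^ i) = 0 := fun i hi => by
      rw [Finset.mem_range] at hi
      rw [Nat.min_eq_right (by omega)]
      ring
    have h : HasSum _ _ := hasSum_sum_of_ne_finset_zero hs0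
    convert h using 1
    rw [Finset.mul_sum]
    refine Finset.sum_nbij' (fun i => i - 1) (fun i => i + 1) ?_ ?_ ?_ ?_ ?_
    · intro i hi; simp only [Finset.mem_Icc, Finset.mem_range] at *; omega
    · intro i hi; simp only [Finset.mem_Icc, Finset.mem_range] at *; omega
    · intro i hi; simp only [Finset.mem_Icc] at *; omega
    · intro i hi; simp
    · intro i hi
      rw [Finset.mem_Icc] at hi
      rw [show i - 1 + 1 = i by omega, Nat.min_eq_left (by omega)]
      ring
  -- Writes `min(i+1, c) - 1` as `c - 1` minus the number of missing servers, which vanishes for `i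
  -- + 1 ≥ c`.
  have hvs : HasSum (fun i => v i * s ^ i) (((c : ℝ) - 1) * b 0 * ∑' i, w (i + 1) * s ^ i -
      b 0 * ∑ i ∈ Finset.Icc 1 (c - 1), w i * s ^ (i - 1) * ((c : ℝ) - i)) := by
    refine ((hw.of_norm.hasSum.mul_left (((c : ℝ) - 1) * b 0)).sub hfin).congr_fun fun i => ?_
    simp only [hv]
    ring
  have hvs' : HasSum (fun j => (if j = 0 then 0 else v (j - 1)) * s ^ j)
      (s * (((c : ℝ) - 1) * b 0 * ∑' i, w (i + 1) * s ^ i -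
      b 0 * ∑ i ∈ Finset.Icc 1 (c - 1), w i * s ^ (i - 1) * ((c : ℝ) - i))) := by
    rw [← hasSum_nat_add_iff' 1]
    simp only [Finset.sum_range_one, if_true, zero_mul, sub_zero]
    refine (hvs.mul_left s).congr_fun fun j => ?_
    simp
    ring
  have htot := (hprod.add hvs).sub hvs'
  have hval : genBi b c s * ∑' i, w (i + 1) * s ^ i -
        (1 - s) * b 0 * ∑ i ∈ Finset.Icc 1 (c - 1), w i * s ^ (i - 1) * ((c : ℝ) - i) =
      (∑' i, w (i + 1) * s ^ i) * ∑' j, b j * s ^ j +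
      (((c : ℝ) - 1) * b 0 * ∑' i, w (i + 1) * s ^ i -
      b 0 * ∑ i ∈ Finset.Icc 1 (c - 1), w i * s ^ (i - 1) * ((c : ℝ) - i)) -
      s * (((c : ℝ) - 1) * b 0 * ∑' i, w (i + 1) * s ^ i -
      b 0 * ∑ i ∈ Finset.Icc 1 (c - 1), w i * s ^ (i - 1) * ((c : ℝ) - i)) := by
    simp only [genBi, genB]
    ring
  rw [hval]
  refine htot.congr_fun fun j => ?_
  have hconv : ∑ i ∈ Finset.range (j + 1), w (i + 1) * s ^ i * (b (j - i) * s ^ (j - i)) =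
      (∑ i ∈ Finset.range (j + 1), w (i + 1) * if i ≤ j then b (j - i) else 0) * s ^ j := by
    rw [Finset.sum_mul]
    refine Finset.sum_congr rfl fun i hi => ?_
    have hij : i ≤ j := Nat.lt_succ_iff.1 (Finset.mem_range.1 hi)
    rw [if_pos hij]
    calc w (i + 1) * s ^ i * (b (j - i) * s ^ (j - i))
        = w (i + 1) * b (j - i) * (s ^ i * s ^ (j - i)) := by ring
      _ = _ := by rw [← pow_add, Nat.add_sub_cancel' hij]
  have hd1 : ∑ i ∈ Finset.range (j + 1), v i * (if i = j then (1 : ℝ) else 0) = v j := by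
    simp
  have hd2 : ∑ i ∈ Finset.range (j + 1), v i * (if i + 1 = j then (1 : ℝ) else 0) =
      if j = 0 then 0 else v (j - 1) := by
    rcases j with _ | j <;> simp
  rw [Finset.sum_range_succ', qStar_zero_left, mul_zero, add_zero, hconv, ← hd1, ← hd2,
    ← add_mul, ← sub_mul, ← Finset.sum_add_distrib, ← Finset.sum_sub_distrib]
  congr 1
  refine Finset.sum_congr rfl fun i _ => ?_
  rw [qStar_succ_eq]
  simp only [hv]
  ring

end QMatrix

section Occupation

/-! ### Occupation times -/

variable {b : ℕ → ℝ} {c : ℕ} {p : ℝ → ℕ → ℕ → ℝ}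

/-- The expected time spent in `i` up to time `t`. -/
def occupationTimeUpTo (p : ℝ → ℕ → ℕ → ℝ) (k i : ℕ) (t : ℝ) : ℝ := ∫ r in (0 : ℝ)..t, p r k i

namespace IsQFunction

theorem sum_occupationTimeUpTo (hp : IsQFunction (qStar b c) p) (hb : IsRateSequence b)
    (hc : 1 ≤ c) (k j : ℕ) {t : ℝ} (ht : 0 ≤ t) :
    ∑ l ∈ Finset.range (j + 2), occupationTimeUpTo p k l t * qStar b c l j =
      p t k j - if k = j then 1 else 0 :=
  hp.forward_integral (neg_le_qStar_diag hc hb) k j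
    (fun l hl => qStar_eq_zero (by simpa using hl)) ht

theorem continuousOn_queue (hp : IsQFunction (qStar b c) p) (hb : IsRateSequence b)
    (hc : 1 ≤ c) (i j : ℕ) : ContinuousOn (fun t => p t i j) (Ici 0) :=
  hp.continuousOn (neg_le_qStar_diag hc hb) i j

theorem intervalIntegrable (hp : IsQFunction (qStar b c) p) (hb : IsRateSequence b)
    (hc : 1 ≤ c) (i j : ℕ) {t : ℝ} (ht : 0 ≤ t) :
    IntervalIntegrable (fun r => p r i j) volume 0 t :=
  ((hp.continuousOn_queue hb hc i j).mono fun x hx => by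
      rw [uIcc_of_le ht] at hx; exact hx.1).intervalIntegrable

theorem occupationTimeUpTo_nonneg (hp : IsQFunction (qStar b c) p) (k i : ℕ) {t : ℝ} (ht : 0 ≤ t) :
    0 ≤ occupationTimeUpTo p k i t :=
  intervalIntegral.integral_nonneg ht fun r hr => hp.nonneg r hr.1 k i

theorem occupationTimeUpTo_le (hp : IsQFunction (qStar b c) p) (hb : IsRateSequence b)
    (hc : 1 ≤ c) (k i : ℕ) {t : ℝ} (ht : 0 ≤ t) : occupationTimeUpTo p k i t ≤ t := by
  have := intervalIntegral.integral_mono_on ht (hp.intervalIntegrable hb hc k i ht)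
    intervalIntegrable_const fun r hr => hp.le_one hr.1 k i
  simpa [occupationTimeUpTo] using this

/-- Column `j` gives `M_{j+1}(t)` the positive coefficient `min(j+1, c) b_0`, and the remaining
terms are bounded by induction. The unbounded time in `0` does no harm, since row `0` vanishes. -/
theorem exists_occupationTimeUpTo_le (hp : IsQFunction (qStar b c) p) (hb : IsRateSequence b)
    (hc : 1 ≤ c) (k : ℕ) : ∀ i, 1 ≤ i → ∃ C, ∀ t, 0 ≤ t → occupationTimeUpTo p k i t ≤ C := by
  intro i
  induction i using Nat.strong_induction_on with
  | _ i ih =>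
  intro hi
  obtain ⟨j, rfl⟩ : ∃ j, i = j + 1 := ⟨i - 1, by omega⟩
  have hD : ∀ l ∈ Finset.range (j + 1),
      ∃ D, ∀ t, 0 ≤ t → -(occupationTimeUpTo p k l t * qStar b c l j) ≤ D := by
    intro l hl
    rcases Nat.eq_zero_or_pos l with rfl | hl0
    · exact ⟨0, fun t _ => by rw [qStar_zero_left]; simp⟩
    · obtain ⟨C, hC⟩ := ih l (Finset.mem_range.1 hl) hl0
      refine ⟨C * |qStar b c l j|, fun t ht => ?_⟩
      have h0 := hp.occupationTimeUpTo_nonneg k l ht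
      rw [← mul_neg]
      exact (mul_le_mul_of_nonneg_left (neg_le_abs _) h0).trans
        (mul_le_mul_of_nonneg_right (hC t ht) (abs_nonneg _))
  choose! D hD using hD
  have hb0 := hb.zero_pos
  have hm : (0 : ℝ) < ((min (j + 1) c : ℕ) : ℝ) := by
    exact_mod_cast lt_min (Nat.succ_pos j) hc
  have hpos := mul_pos hm hb0
  refine ⟨(1 + ∑ l ∈ Finset.range (j + 1), D l) / (((min (j + 1) c : ℕ) : ℝ) * b 0),
    fun t ht => ?_⟩
  rw [le_div_iff₀ hpos, ← qStar_succ_left]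
  have h := hp.sum_occupationTimeUpTo hb hc k j ht
  rw [Finset.sum_range_succ] at h
  have h1 : p t k j - (if k = j then 1 else 0) ≤ 1 := by
    have := hp.le_one ht k j
    split_ifs <;> linarith
  have h2 := Finset.sum_le_sum fun l hl => hD l hl t ht
  rw [Finset.sum_neg_distrib] at h2
  linarith

theorem integrableOn (hp : IsQFunction (qStar b c) p) (hb : IsRateSequence b)
    (hc : 1 ≤ c) (k : ℕ) {i : ℕ} (hi : 1 ≤ i) : IntegrableOn (fun t => p t k i) (Ioi 0) := by
  obtain ⟨C, hC⟩ := hp.exists_occupationTimeUpTo_le hb hc k i hi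
  refine integrableOn_Ioi_of_intervalIntegral_norm_bounded (l := atTop) (b := fun n : ℕ => (n : ℝ))
    C 0 (fun n => ?_) tendsto_natCast_atTop_atTop (Eventually.of_forall fun n => ?_)
  · have := hp.intervalIntegrable hb hc k i (Nat.cast_nonneg n)
    rwa [intervalIntegrable_iff_integrableOn_Ioc_of_le (Nat.cast_nonneg n)] at this
  · refine le_of_eq_of_le ?_ (hC n (Nat.cast_nonneg n))
    refine intervalIntegral.integral_congr fun r hr => ?_
    rw [uIcc_of_le (Nat.cast_nonneg n)] at hr
    exact Real.norm_of_nonneg (hp.nonneg r hr.1 k i)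

theorem tendsto_occupationTimeUpTo (hp : IsQFunction (qStar b c) p) (hb : IsRateSequence b)
    (hc : 1 ≤ c) (k : ℕ) {i : ℕ} (hi : 1 ≤ i) :
    Tendsto (occupationTimeUpTo p k i) atTop (𝓝 (occupationTime p k i)) :=
  intervalIntegral_tendsto_integral_Ioi 0 (hp.integrableOn hb hc k hi) tendsto_id

theorem occupationTime_nonneg (hp : IsQFunction (qStar b c) p) (k i : ℕ) :
    0 ≤ occupationTime p k i :=
  setIntegral_nonneg measurableSet_Ioi fun t ht => hp.nonneg t (le_of_lt ht) k i

theorem tendsto_sum_occupationTimeUpTo (hp : IsQFunction (qStar b c) p) (hb : IsRateSequence b)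
    (hc : 1 ≤ c) (k j : ℕ) :
    Tendsto (fun t => p t k j - if k = j then 1 else 0) atTop
      (𝓝 (∑ l ∈ Finset.range (j + 2), occupationTime p k l * qStar b c l j)) := by
  have h : Tendsto (fun t => ∑ l ∈ Finset.range (j + 2),
      occupationTimeUpTo p k l t * qStar b c l j) atTop
      (𝓝 (∑ l ∈ Finset.range (j + 2), occupationTime p k l * qStar b c l j)) := by
    refine tendsto_finsetSum _ fun l _ => ?_
    -- For `l = 0` the integral need not converge and `occupationTime p k 0` may be a default value;
    -- the zero row of `Q*` removes it.
    rcases Nat.eq_zero_or_pos l with rfl | hl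
    · simp [qStar_zero_left]
    · exact (hp.tendsto_occupationTimeUpTo hb hc k hl).mul_const _
  refine h.congr' ?_
  filter_upwards [eventually_ge_atTop 0] with t ht
  exact hp.sum_occupationTimeUpTo hb hc k j ht

theorem tendsto_absorbed (hp : IsQFunction (qStar b c) p) (hb : IsRateSequence b)
    (hc : 1 ≤ c) {k : ℕ} (hk : 1 ≤ k) :
    Tendsto (fun t => p t k 0) atTop (𝓝 (b 0 * occupationTime p k 1)) := by
  have h := hp.tendsto_sum_occupationTimeUpTo hb hc k 0
  rw [zero_add, sum_mul_qStar_zero hc, if_neg (by omega)] at h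
  simpa using h

/-- The column identity shows that the limit exists; integrability over the half-line forces it to
be `0`. -/
theorem tendsto_transient (hp : IsQFunction (qStar b c) p) (hb : IsRateSequence b)
    (hc : 1 ≤ c) (k : ℕ) {j : ℕ} (hj : 1 ≤ j) : Tendsto (fun t => p t k j) atTop (𝓝 0) := by
  have h := (hp.tendsto_sum_occupationTimeUpTo hb hc k j).add_const (if k = j then (1 : ℝ) else 0)
  simp only [sub_add_cancel] at h
  set L := ∑ l ∈ Finset.range (j + 2), occupationTime p k l * qStar b c l j +
    if k = j then (1 : ℝ) else 0
  have hL0 : 0 ≤ L := by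
    refine ge_of_tendsto h ?_
    filter_upwards [eventually_ge_atTop 0] with t ht using hp.nonneg t ht k j
  rcases hL0.eq_or_lt with hL | hL
  · rwa [← hL] at h
  exfalso
  obtain ⟨T, hT⟩ := eventually_atTop.1 (h.eventually (lt_mem_nhds (half_lt_self hL)))
  have hint : IntegrableOn (fun t => p t k j) (Ioi (max T 0)) :=
    (hp.integrableOn hb hc k hj).mono_set (Ioi_subset_Ioi (le_max_right _ _))
  have hconst : IntegrableOn (fun _ => L / 2) (Ioi (max T 0)) := by
    refine Integrable.mono' hint aestronglyMeasurable_const ?_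
    filter_upwards [ae_restrict_mem measurableSet_Ioi] with t ht
    rw [Real.norm_of_nonneg (by positivity)]
    exact (hT t ((le_max_left _ _).trans (le_of_lt ht))).le
  rw [integrableOn_const_iff] at hconst
  simp [hL.ne'] at hconst

theorem sum_occupationTime (hp : IsQFunction (qStar b c) p) (hb : IsRateSequence b)
    (hc : 1 ≤ c) (k : ℕ) {j : ℕ} (hj : 1 ≤ j) :
    ∑ l ∈ Finset.range (j + 2), occupationTime p k l * qStar b c l j =
      -(if k = j then 1 else 0) := by
  have h1 := hp.tendsto_sum_occupationTimeUpTo hb hc k j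
  have h2 := (hp.tendsto_transient hb hc k hj).sub_const (if k = j then (1 : ℝ) else 0)
  rw [zero_sub] at h2
  exact tendsto_nhds_unique h1 h2

/-- Here `e` is `b_0 m_1` by definition; its identification with the extinction probability is made
later, from the paths. -/
theorem occupationRecursion (hp : IsQFunction (qStar b c) p) (hb : IsRateSequence b)
    (hc : 1 ≤ c) (k : ℕ) :
    OccupationRecursion b c k (b 0 * occupationTime p k 1) (occupationTime p k) where
  absorb := rfl
  balance j hj := by rw [← sum_mul_qStar _ hj, hp.sum_occupationTime hb hc k hj]

end IsQFunction

/-- The right-hand side of `B_c(s) ∑ m_i s^(i-1) = e - s^k + (1-s) b_0 ∑_{i<c} (c-i) m_i s^(i-1)`. -/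
def occupationNumerator (b : ℕ → ℝ) (c k : ℕ) (e : ℝ) (m : ℕ → ℝ) (s : ℝ) : ℝ :=
  e - s ^ k + (1 - s) * b 0 * ∑ i ∈ Finset.Icc 1 (c - 1), m i * s ^ (i - 1) * ((c : ℝ) - i)

/-! ### The generating function of the occupation times -/

namespace IsQFunction

/-- The geometric weights dominate, so mass escaping to infinity contributes nothing in the limit.
-/
theorem tendsto_pgf (hp : IsQFunction (qStar b c) p) (hb : IsRateSequence b)
    (hc : 1 ≤ c) {k : ℕ} (hk : 1 ≤ k) {s : ℝ} (hs : s ∈ Ico (0 : ℝ) 1) :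
    Tendsto (fun t => ∑' j, p t k j * s ^ j) atTop (𝓝 (b 0 * occupationTime p k 1)) := by
  have h := tendsto_tsum_of_dominated_convergence (𝓕 := atTop) (f := fun t j => p t k j * s ^ j)
    (g := fun j => if j = 0 then b 0 * occupationTime p k 1 else 0) (bound := fun j => s ^ j)
    (summable_geometric_of_lt_one hs.1 hs.2) (fun j => ?_) ?_
  · simpa using h
  · rcases Nat.eq_zero_or_pos j with rfl | hj
    · simpa using hp.tendsto_absorbed hb hc hk
    · rw [if_neg (by omega)]
      simpa using (hp.tendsto_transient hb hc k hj).mul_const (s ^ j)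
  · filter_upwards [eventually_ge_atTop 0] with t ht j
    have h0 := pow_nonneg hs.1 j
    rw [norm_mul, Real.norm_of_nonneg (hp.nonneg t ht k j), Real.norm_of_nonneg h0]
    exact mul_le_of_le_one_left h0 (hp.le_one ht k j)

theorem summable_occupationTimeUpTo (hp : IsQFunction (qStar b c) p) (hb : IsRateSequence b)
    (hc : 1 ≤ c) (k : ℕ) {s : ℝ} (hs : s ∈ Ico (0 : ℝ) 1) {t : ℝ} (ht : 0 ≤ t) :
    Summable fun i => ‖occupationTimeUpTo p k (i + 1) t * s ^ i‖ := by
  refine ((summable_geometric_of_lt_one hs.1 hs.2).mul_left t).of_nonneg_of_le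
    (fun _ => norm_nonneg _) fun i => ?_
  have h0 := pow_nonneg hs.1 i
  rw [norm_mul, Real.norm_of_nonneg (hp.occupationTimeUpTo_nonneg k _ ht), Real.norm_of_nonneg h0]
  exact mul_le_mul_of_nonneg_right (hp.occupationTimeUpTo_le hb hc k _ ht) h0

/-- At a finite horizon the series converges for every `s < 1`, because `M_i(t) ≤ t`. For the `m_i`
themselves convergence is not known in advance, hence this detour through `t`. -/
theorem genBi_mul_tsum_upTo (hp : IsQFunction (qStar b c) p) (hb : IsRateSequence b)
    (hc : 1 ≤ c) (k : ℕ) {s : ℝ} (hs : s ∈ Ico (0 : ℝ) 1) {t : ℝ} (ht : 0 ≤ t) :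
    genBi b c s * ∑' i, occupationTimeUpTo p k (i + 1) t * s ^ i =
      occupationNumerator b c k (∑' j, p t k j * s ^ j) (fun i => occupationTimeUpTo p k i t) s := by
  have h := hasSum_sum_mul_qStar_mul_pow (c := c) (w := fun i => occupationTimeUpTo p k i t) hb
    (Ico_subset_Icc_self hs) (hp.summable_occupationTimeUpTo hb hc k hs ht)
  have h1 : Summable fun j => p t k j * s ^ j :=
    Summable.of_nonneg_of_le
      (fun j => mul_nonneg (hp.nonneg t ht k j) (pow_nonneg hs.1 j))
      (fun j => mul_le_of_le_one_right (hp.nonneg t ht k j) (pow_le_one₀ hs.1 hs.2.le))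
      (hp.summable t ht k)
  have h2 : HasSum (fun j => if j = k then s ^ k else 0) (s ^ k) := hasSum_ite_eq k _
  have h3 := (h1.hasSum.sub h2).unique <| h.congr_fun fun j => by
    rw [hp.sum_occupationTimeUpTo hb hc k j ht]
    by_cases hjk : j = k
    · simp [hjk, sub_mul]
    · simp [hjk, Ne.symm hjk]
  unfold occupationNumerator
  linarith

theorem tendsto_occupationNumerator (hp : IsQFunction (qStar b c) p) (hb : IsRateSequence b)
    (hc : 1 ≤ c) {k : ℕ} (hk : 1 ≤ k) {s : ℝ} (hs : s ∈ Ico (0 : ℝ) 1) :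
    Tendsto (fun t => genBi b c s * ∑' i, occupationTimeUpTo p k (i + 1) t * s ^ i) atTop
      (𝓝 (occupationNumerator b c k (b 0 * occupationTime p k 1) (occupationTime p k) s)) := by
  have h : Tendsto (fun t => occupationNumerator b c k (∑' j, p t k j * s ^ j)
      (fun i => occupationTimeUpTo p k i t) s) atTop
      (𝓝 (occupationNumerator b c k (b 0 * occupationTime p k 1) (occupationTime p k) s)) := by
    unfold occupationNumerator
    refine ((hp.tendsto_pgf hb hc hk hs).sub_const _).add (Tendsto.const_mul _ ?_)
    refine tendsto_finsetSum _ fun i hi => ?_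
    exact ((hp.tendsto_occupationTimeUpTo hb hc k (Finset.mem_Icc.1 hi).1).mul_const _).mul_const _
  refine h.congr' ?_
  filter_upwards [eventually_ge_atTop 0] with t ht
  exact (hp.genBi_mul_tsum_upTo hb hc k hs ht).symm

/-- The left side is `0` for every `t`, so the limit vanishes without any claim about the
convergence of `∑ m_i s^(i-1)`. -/
theorem occupationNumerator_eq_zero (hp : IsQFunction (qStar b c) p) (hb : IsRateSequence b)
    (hc : 1 ≤ c) {k : ℕ} (hk : 1 ≤ k) {s : ℝ} (hs : s ∈ Ico (0 : ℝ) 1) (hB : genBi b c s = 0) :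
    occupationNumerator b c k (b 0 * occupationTime p k 1) (occupationTime p k) s = 0 := by
  have := hp.tendsto_occupationNumerator hb hc hk hs
  simp only [hB, zero_mul] at this
  exact tendsto_nhds_unique this tendsto_const_nhds

/-- Partial sums survive the limit `t → ∞` by nonnegativity. This gives summability where `B_c(s) >
0`, and with `N = 0` the sign of the numerator. -/
theorem genBi_mul_sum_le (hp : IsQFunction (qStar b c) p) (hb : IsRateSequence b)
    (hc : 1 ≤ c) {k : ℕ} (hk : 1 ≤ k) {s : ℝ} (hs : s ∈ Ico (0 : ℝ) 1) (hB : 0 ≤ genBi b c s)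
    (N : ℕ) :
    genBi b c s * ∑ i ∈ Finset.range N, occupationTime p k (i + 1) * s ^ i ≤
      occupationNumerator b c k (b 0 * occupationTime p k 1) (occupationTime p k) s := by
  have h1 : Tendsto (fun t => genBi b c s *
      ∑ i ∈ Finset.range N, occupationTimeUpTo p k (i + 1) t * s ^ i) atTop
      (𝓝 (genBi b c s * ∑ i ∈ Finset.range N, occupationTime p k (i + 1) * s ^ i)) :=
    (tendsto_finsetSum _ fun i _ =>
      (hp.tendsto_occupationTimeUpTo hb hc k (Nat.le_add_left 1 i)).mul_const _).const_mul _
  refine le_of_tendsto_of_tendsto h1 (hp.tendsto_occupationNumerator hb hc hk hs) ?_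
  filter_upwards [eventually_ge_atTop 0] with t ht
  refine mul_le_mul_of_nonneg_left ?_ hB
  exact (hp.summable_occupationTimeUpTo hb hc k hs ht).of_norm.sum_le_tsum _ fun i _ =>
    mul_nonneg (hp.occupationTimeUpTo_nonneg k _ ht) (pow_nonneg hs.1 i)

theorem summable_occupationTime_mul_pow (hp : IsQFunction (qStar b c) p) (hb : IsRateSequence b)
    (hc : 1 ≤ c) {k : ℕ} (hk : 1 ≤ k) {s : ℝ} (hs : s ∈ Ico (0 : ℝ) 1) (hB : 0 < genBi b c s) :
    Summable fun i => occupationTime p k (i + 1) * s ^ i := by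
  refine summable_of_sum_range_le (c := occupationNumerator b c k (b 0 * occupationTime p k 1)
    (occupationTime p k) s / genBi b c s) (fun i => mul_nonneg (hp.occupationTime_nonneg k _)
    (pow_nonneg hs.1 i)) fun N => ?_
  exact (le_div_iff₀' hB).2 (hp.genBi_mul_sum_le hb hc hk hs hB.le N)

/-- The generating function of the occupation times. -/
theorem genBi_mul_tsum (hp : IsQFunction (qStar b c) p) (hb : IsRateSequence b)
    (hc : 1 ≤ c) {k : ℕ} (hk : 1 ≤ k) {s : ℝ} (hs : s ∈ Ico (0 : ℝ) 1) (hB : 0 < genBi b c s) :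
    genBi b c s * ∑' i, occupationTime p k (i + 1) * s ^ i =
      occupationNumerator b c k (b 0 * occupationTime p k 1) (occupationTime p k) s := by
  have h := hasSum_sum_mul_qStar_mul_pow (c := c) (w := occupationTime p k) hb (Ico_subset_Icc_self hs)
    (hp.summable_occupationTime_mul_pow hb hc hk hs hB).norm
  have h1 : HasSum (fun j => if j = 0 then b 0 * occupationTime p k 1 else 0)
      (b 0 * occupationTime p k 1) := hasSum_ite_eq 0 _
  have h2 : HasSum (fun j => if j = k then s ^ k else 0) (s ^ k) := hasSum_ite_eq k _
  have h3 := (h1.sub h2).unique <| h.congr_fun fun j => by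
    rcases Nat.eq_zero_or_pos j with rfl | hj
    · rw [zero_add, sum_mul_qStar_zero hc, if_neg (show (0 : ℕ) ≠ k by omega)]
      simp
    · rw [hp.sum_occupationTime hb hc k hj, if_neg (show j ≠ 0 by omega)]
      by_cases hjk : j = k
      · simp [hjk]
      · simp [hjk, Ne.symm hjk]
  unfold occupationNumerator
  linarith

end IsQFunction

end Occupation

section Roots

variable {b : ℕ → ℝ} {c : ℕ} {p : ℝ → ℕ → ℕ → ℝ}

/-! ### The roots of `B_i` -/

theorem IsRateSequence.summable (hb : IsRateSequence b) : Summable b := hb.summable_abs.of_abs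

theorem IsRateSequence.genB_one (hb : IsRateSequence b) : genB b 1 = 0 := by
  have h1 : HasSum (fun j => if j = 1 then b 1 else 0) (b 1) := hasSum_ite_eq 1 _
  have h := hb.hasSum.add h1
  rw [neg_add_cancel] at h
  unfold genB
  refine (HasSum.congr_fun h fun j => ?_).tsum_eq
  by_cases hj : j = 1 <;> simp [hj]

theorem IsRateSequence.genBi_one (hb : IsRateSequence b) (i : ℕ) : genBi b i 1 = 0 := by
  simp [genBi, hb.genB_one]

theorem genBi_zero (i : ℕ) : genBi b i 0 = i * b 0 := by
  have : genB b 0 = b 0 := by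
    unfold genB
    rw [tsum_eq_single 0 fun j hj => by simp [hj]]
    simp
  rw [genBi, this]
  ring

theorem IsRateSequence.continuousOn_genBi (hb : IsRateSequence b) (i : ℕ) :
    ContinuousOn (genBi b i) (Icc 0 1) := by
  have h : ContinuousOn (genB b) (Icc 0 1) :=
    continuousOn_tsum (fun j => by fun_prop) hb.summable_abs fun j s hs =>
      IsRateSequence.abs_mul_pow_le hs j
  unfold genBi
  fun_prop

theorem IsRateSequence.slope_genBi (hb : IsRateSequence b) (i : ℕ) (s : ℝ) :
    slope (genBi b i) 1 s = genBi b i s / (s - 1) := by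
  rw [slope_def_field, hb.genBi_one, sub_zero]

theorem genBiDerivOne_ne_bot (i : ℕ) : genBiDerivOne b i ≠ ⊥ := by
  rw [genBiDerivOne, Ne, EReal.add_eq_bot_iff]
  exact not_or.2 ⟨EReal.coe_ennreal_ne_bot _, EReal.coe_ne_bot _⟩

theorem one_add_mul_sub_one_lt_pow {s : ℝ} (hs : s ∈ Ico (0 : ℝ) 1) {j : ℕ} (hj : 2 ≤ j) :
    1 + (j : ℝ) * (s - 1) < s ^ j := by
  obtain ⟨n, rfl⟩ : ∃ n, j = n + 2 := ⟨j - 2, by omega⟩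
  have h1 := one_add_mul_le_pow (a := s - 1) (by linarith [hs.1]) (n + 1)
  rw [add_sub_cancel] at h1
  have h2 := mul_le_mul_of_nonneg_left h1 hs.1
  have h3 : 0 < ((n : ℝ) + 1) * (s - 1) ^ 2 := by
    have : s - 1 ≠ 0 := by linarith [hs.2]
    positivity
  have h4 : s ^ (n + 2) = s * s ^ (n + 1) := by ring
  rw [h4]
  push_cast at h2 ⊢
  nlinarith

theorem IsRateSequence.exists_pos (hb : IsRateSequence b) : ∃ j, 2 ≤ j ∧ 0 < b j := by
  by_contra! h
  have : ∑' j, b (j + 2) ≤ 0 := tsum_nonpos fun j => h (j + 2) (by omega)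
  linarith [hb.tail_pos]

/-- `B_i` lies above its tangent at `1`, strictly because some `b_j` with `j ≥ 2` is positive; a
tangent through `(1, 0)` with slope `≤ 0` is nonnegative to the left of `1`. -/
theorem genBi_pos (hb : IsRateSequence b) {i : ℕ} (hd : genBiDerivOne b i ≤ 0) {s : ℝ}
    (hs : s ∈ Ico (0 : ℝ) 1) : 0 < genBi b i s := by
  set a : ℕ → ℝ := fun j => if j = 1 then 0 else b j with ha
  have ha0 : ∀ j, 0 ≤ a j := by
    intro j
    by_cases h : j = 1
    · simp [ha, h]
    · simpa [ha, h] using hb.nonneg j h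
  have hja : ∀ j : ℕ, (if j = 1 then 0 else (j : ℝ) * b j) = j * a j := by
    intro j
    by_cases h : j = 1 <;> simp [ha, h]
  have hja0 : ∀ j : ℕ, 0 ≤ (j : ℝ) * a j := fun j => mul_nonneg (Nat.cast_nonneg _) (ha0 j)
  simp only [genBiDerivOne, hja] at hd
  -- A divergent series would make the derivative `+∞`, against `hd`; so the tangent has a finite
  -- slope.
  have hfin : ∑' j, ENNReal.ofReal (j * a j) ≠ ∞ := by
    intro h
    rw [h, EReal.coe_ennreal_top, EReal.top_add_coe] at hd
    simp at hd
  have hS : Summable fun j : ℕ => (j : ℝ) * a j := by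
    have := ENNReal.summable_toReal hfin
    exact this.congr fun j => ENNReal.toReal_ofReal (hja0 j)
  rw [← ENNReal.ofReal_tsum_of_nonneg hja0 hS, EReal.coe_ennreal_ofReal,
    max_eq_left (tsum_nonneg hja0), ← EReal.coe_add] at hd
  have hd : ∑' j : ℕ, (j : ℝ) * a j + (b 1 - ((i : ℝ) - 1) * b 0) ≤ 0 := by exact_mod_cast hd
  have haS : HasSum a (-b 1) := hb.hasSum
  have hpow : Summable fun j => a j * s ^ j :=
    haS.summable.of_nonneg_of_le (fun j => mul_nonneg (ha0 j) (pow_nonneg hs.1 j))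
      fun j => mul_le_of_le_one_right (ha0 j) (pow_le_one₀ hs.1 hs.2.le)
  have hlin : HasSum (fun j : ℕ => a j * (1 + (j : ℝ) * (s - 1)))
      (-b 1 + (∑' j : ℕ, (j : ℝ) * a j) * (s - 1)) :=
    (haS.add (hS.hasSum.mul_right (s - 1))).congr_fun fun j => by ring
  have hle : ∀ j : ℕ, a j * (1 + (j : ℝ) * (s - 1)) ≤ a j * s ^ j := by
    intro j
    refine mul_le_mul_of_nonneg_left ?_ (ha0 j)
    have h1 := one_add_mul_le_pow (a := s - 1) (by linarith [hs.1]) j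
    rwa [add_sub_cancel] at h1
  obtain ⟨j, hj, hbj⟩ := hb.exists_pos
  have hlt : a j * (1 + (j : ℝ) * (s - 1)) < a j * s ^ j := by
    refine mul_lt_mul_of_pos_left (one_add_mul_sub_one_lt_pow hs hj) ?_
    simpa [ha, show j ≠ 1 by omega] using hbj
  have hkey := Summable.tsum_lt_tsum hle hlt hlin.summable hpow
  rw [hlin.tsum_eq] at hkey
  have hgen : genB b s = ∑' j, a j * s ^ j + b 1 * s := by
    have h1 : HasSum (fun j => if j = 1 then b 1 * s else 0) (b 1 * s) := hasSum_ite_eq 1 _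
    refine (HasSum.congr_fun (hpow.hasSum.add h1) fun j => ?_).tsum_eq
    by_cases h : j = 1 <;> simp [ha, h]
  rw [genBi, hgen]
  nlinarith [mul_nonneg (sub_nonneg.2 hs.2.le) (sub_nonneg.2 hd)]

/-- A positive slope at `1`, where `B_i` vanishes, makes `B_i` negative just to the left, while
`B_i(0) = i b_0 ≥ 0`. -/
theorem exists_root_lt_one (hb : IsRateSequence b) {i : ℕ} (hd : 0 < genBiDerivOne b i) :
    ∃ s ∈ Ico (0 : ℝ) 1, genBi b i s = 0 := by
  have hev := (tendsto_slope_genBi hb i).eventually (lt_mem_nhds hd)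
  obtain ⟨s, hs, hs01⟩ := (hev.and (Ioo_mem_nhdsLT (zero_lt_one' ℝ))).exists
  rw [hb.slope_genBi] at hs
  have hs : 0 < genBi b i s / (s - 1) := by exact_mod_cast hs
  have hneg : genBi b i s < 0 := by
    by_contra! h
    exact absurd hs (not_lt.2 (div_nonpos_of_nonneg_of_nonpos h (by linarith [hs01.2])))
  have h0 : 0 ≤ genBi b i 0 := by
    rw [genBi_zero]
    exact mul_nonneg (Nat.cast_nonneg _) hb.zero_pos.le
  obtain ⟨r, hr, hr0⟩ := intermediate_value_Icc' hs01.1.le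
    ((hb.continuousOn_genBi i).mono (Icc_subset_Icc_right hs01.2.le)) ⟨hneg.le, h0⟩
  exact ⟨r, ⟨hr.1, hr.2.trans_lt hs01.2⟩, hr0⟩

theorem exists_isLeast_root (hb : IsRateSequence b) (i : ℕ) :
    ∃ u, IsLeast {s | s ∈ Icc (0 : ℝ) 1 ∧ genBi b i s = 0} u := by
  have hcl : IsClosed (Icc (0 : ℝ) 1 ∩ genBi b i ⁻¹' {0}) :=
    (hb.continuousOn_genBi i).preimage_isClosed_of_isClosed isClosed_Icc isClosed_singleton
  have hcp : IsCompact {s | s ∈ Icc (0 : ℝ) 1 ∧ genBi b i s = 0} :=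
    isCompact_Icc.of_isClosed_subset hcl inter_subset_left
  exact hcp.exists_isLeast ⟨1, ⟨zero_le_one, le_rfl⟩, hb.genBi_one i⟩

/-! ### Uniqueness for the linear systems -/

theorem sum_Icc_one_eq_sum_range {M : Type*} [AddCommMonoid M] (f : ℕ → M) (n : ℕ) :
    ∑ i ∈ Finset.Icc 1 n, f i = ∑ i ∈ Finset.range n, f (i + 1) := by
  have : Finset.Icc 1 n = Finset.Ico 1 (n + 1) := by ext; simp
  rw [this, Finset.sum_Ico_eq_sum_range]
  simp [add_comm]

/-- The system is triangular: equation `j` determines `m_{j+1}`, with coefficient `min(j+1, c) b_0 ≠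
0`. -/
theorem OccupationRecursion.unique (hb : IsRateSequence b) (hc : 1 ≤ c) {k : ℕ} {e : ℝ}
    {m m' : ℕ → ℝ} (h : OccupationRecursion b c k e m) (h' : OccupationRecursion b c k e m') :
    ∀ i, 1 ≤ i → m i = m' i := by
  intro i
  induction i using Nat.strong_induction_on with
  | _ i ih =>
  intro hi
  rcases hi.eq_or_lt with rfl | hi
  · exact mul_left_cancel₀ hb.zero_pos.ne' (h.absorb.trans h'.absorb.symm)
  obtain ⟨j, rfl⟩ : ∃ j, i = j + 1 := ⟨i - 1, by omega⟩
  have hj : 1 ≤ j := by omega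
  have h1 := (h.balance j hj).trans (h'.balance j hj).symm
  have h2 : ∑ i ∈ Finset.Icc 1 (j - 1), b (j - i + 1) * m i =
      ∑ i ∈ Finset.Icc 1 (j - 1), b (j - i + 1) * m' i :=
    Finset.sum_congr rfl fun i hi => by
      rw [Finset.mem_Icc] at hi
      rw [ih i (by omega) hi.1]
  rw [h2, ih j (by omega) hj] at h1
  have hm : ((min (j + 1) c : ℕ) : ℝ) * b 0 ≠ 0 := by
    refine mul_ne_zero ?_ hb.zero_pos.ne'
    exact_mod_cast (lt_min (Nat.succ_pos j) hc).ne'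
  exact mul_left_cancel₀ hm (add_left_cancel h1)

theorem IsRateSequence.tsum_tail_succ (hb : IsRateSequence b) (n : ℕ) :
    ∑' j, b (j + n) = b n + ∑' j, b (j + (n + 1)) := by
  have h := ((summable_nat_add_iff n).2 hb.summable).tsum_eq_zero_add
  rw [h, zero_add]
  congr 1
  exact tsum_congr fun j => by rw [add_right_comm, add_assoc]

/-- In a homogeneous solution of the balance equations the flow down from `M + 1` to `M` equals the
absorption rate plus the flow upwards across the level `M`. -/
theorem flow_across_level (hb : IsRateSequence b) {n : ℕ → ℝ}
    (h : ∀ j, 1 ≤ j → j + 2 ≤ c →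
      ∑ i ∈ Finset.Icc 1 (j - 1), b (j - i + 1) * n i + (b 1 - ((j : ℝ) - 1) * b 0) * n j
        + ((j : ℝ) + 1) * b 0 * n (j + 1) = 0) (M : ℕ) (hM : M + 2 ≤ c) :
    ((M : ℝ) + 1) * b 0 * n (M + 1) =
      b 0 * n 1 + ∑ i ∈ Finset.range M, n (i + 1) * ∑' j, b (j + (M - i + 1)) := by
  induction M with
  | zero => simp
  | succ M ih =>
    have h1 := ih (by omega)
    have h2 := h (M + 1) (by omega) (by omega)
    have hB : b 1 + b 0 + ∑' j, b (j + 2) = 0 := by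
      have h3 := hb.tsum_tail_succ 0
      have h4 := hb.tsum_tail_succ 1
      have h5 := hb.genB_one
      simp only [genB, one_pow, mul_one] at h5
      simp only [add_zero, zero_add, h5] at h3
      simp only [Nat.reduceAdd] at h4
      rw [h4] at h3
      linarith
    rw [Nat.add_sub_cancel, sum_Icc_one_eq_sum_range] at h2
    rw [Finset.sum_range_succ]
    -- Raising the level by one removes the first term of each tail, and these terms are the jump
    -- rates in balance equation `M + 1`.
    have h6 : ∑ i ∈ Finset.range M, n (i + 1) * ∑' j, b (j + (M - i + 1)) =
        ∑ i ∈ Finset.range M, b (M + 1 - (i + 1) + 1) * n (i + 1) +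
        ∑ i ∈ Finset.range M, n (i + 1) * ∑' j, b (j + (M + 1 - i + 1)) := by
      rw [← Finset.sum_add_distrib]
      refine Finset.sum_congr rfl fun i hi => ?_
      have := Finset.mem_range.1 hi
      rw [hb.tsum_tail_succ (M - i + 1), show M + 1 - (i + 1) + 1 = M - i + 1 by omega,
        show M + 1 - i + 1 = M - i + 1 + 1 by omega]
      ring
    rw [show M + 1 - M + 1 = 2 by omega]
    rw [Nat.cast_succ] at h2 ⊢
    rw [h6] at h1
    linear_combination h2 + h1 - n (M + 1) * hB

/-- The flow identity has nonnegative coefficients, unlike the balance equations: its tails start at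
index at least `2`, so `b_1` never occurs. Nonnegativity therefore propagates upwards from `n 1`. -/
theorem nonneg_of_balance (hb : IsRateSequence b) {n : ℕ → ℝ}
    (h : ∀ j, 1 ≤ j → j + 2 ≤ c →
      ∑ i ∈ Finset.Icc 1 (j - 1), b (j - i + 1) * n i + (b 1 - ((j : ℝ) - 1) * b 0) * n j
        + ((j : ℝ) + 1) * b 0 * n (j + 1) = 0) (h1 : 2 ≤ c → 0 ≤ b 0 * n 1) :
    ∀ i, 1 ≤ i → i ≤ c - 1 → 0 ≤ n i := by
  intro i
  induction i using Nat.strong_induction_on with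
  | _ i ih =>
  intro hi hic
  obtain ⟨M, rfl⟩ : ∃ M, i = M + 1 := ⟨i - 1, by omega⟩
  have hfl := flow_across_level hb h M (by omega)
  have hpos : 0 < ((M : ℝ) + 1) * b 0 := mul_pos (by positivity) hb.zero_pos
  refine nonneg_of_mul_nonneg_right ?_ hpos
  rw [hfl]
  refine add_nonneg (h1 (by omega)) (Finset.sum_nonneg fun i hi => ?_)
  have hi := Finset.mem_range.1 hi
  exact mul_nonneg (ih (i + 1) (by omega) (by omega) (by omega))
    (tsum_nonneg fun j => hb.nonneg _ (by omega))

theorem ExtinctionSystem.le_of_le (hb : IsRateSequence b) {k : ℕ} {u e e' : ℝ} {m m' : ℕ → ℝ}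
    (h : ExtinctionSystem b c k u e m) (h' : ExtinctionSystem b c k u e' m') (he : e' ≤ e) :
    ∀ i, 1 ≤ i → i ≤ c - 1 → m' i ≤ m i := by
  intro i hi hic
  refine sub_nonneg.1 (nonneg_of_balance (c := c) hb (n := fun i => m i - m' i)
    (fun j hj hjc => ?_) (fun h2 => ?_) i hi hic)
  · have h1 := h.balance j hj hjc
    have h2 := h'.balance j hj hjc
    simp only [mul_sub, Finset.sum_sub_distrib]
    linear_combination h1 - h2
  · rw [mul_sub, h.absorb h2, h'.absorb h2]
    exact sub_nonneg.2 he

/-- If `e > e'`, then `m ≥ m'` by `le_of_le`, and the root equation, in which the `m_i` have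
coefficients `≤ 0`, gives `e ≤ e'`. -/
theorem ExtinctionSystem.prob_le (hb : IsRateSequence b) {k : ℕ} {u e e' : ℝ} {m m' : ℕ → ℝ}
    (hu : u ∈ Icc (0 : ℝ) 1)
    (h : ExtinctionSystem b c k u e m) (h' : ExtinctionSystem b c k u e' m') : e ≤ e' := by
  by_contra! hlt
  have hm := h.le_of_le hb h' hlt.le
  refine absurd hlt (not_lt.2 ?_)
  rw [h.root, h'.root]
  refine sub_le_sub_left (Finset.sum_le_sum fun i hi => ?_) _
  rw [Finset.mem_Icc] at hi
  have hic : (i : ℝ) ≤ c := by exact_mod_cast (by omega : i ≤ c)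
  refine mul_le_mul_of_nonneg_right (mul_le_mul_of_nonneg_right (mul_le_mul_of_nonneg_right
    (mul_le_mul_of_nonneg_right (hm i hi.1 hi.2) ?_) ?_) hb.zero_pos.le) ?_
  exacts [pow_nonneg hu.1 _, sub_nonneg.2 hic, sub_nonneg.2 hu.2]

theorem ExtinctionSystem.unique (hb : IsRateSequence b) {k : ℕ} {u e e' : ℝ} {m m' : ℕ → ℝ}
    (hu : u ∈ Icc (0 : ℝ) 1)
    (h : ExtinctionSystem b c k u e m) (h' : ExtinctionSystem b c k u e' m') :
    e = e' ∧ ∀ i, 1 ≤ i → i ≤ c - 1 → m i = m' i := by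
  have he := h.prob_le hb hu h'
  have he' := h'.prob_le hb hu h
  exact ⟨he.antisymm he', fun i hi hic =>
    (h'.le_of_le hb h he i hi hic).antisymm (h.le_of_le hb h' he' i hi hic)⟩

/-! ### Extinction probability and total occupation time -/

theorem continuous_occupationNumerator (k : ℕ) (e : ℝ) (m : ℕ → ℝ) :
    Continuous (occupationNumerator b c k e m) := by
  unfold occupationNumerator
  fun_prop

namespace IsQFunction

theorem absorbed_le_one (hp : IsQFunction (qStar b c) p) (hb : IsRateSequence b)
    (hc : 1 ≤ c) {k : ℕ} (hk : 1 ≤ k) : b 0 * occupationTime p k 1 ≤ 1 := by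
  refine le_of_tendsto (hp.tendsto_absorbed hb hc hk) ?_
  filter_upwards [eventually_ge_atTop 0] with t ht using hp.le_one ht k 0

/-- The numerator is nonnegative on `[0, 1)` and tends to `e - 1` at `1`. -/
theorem absorbed_eq_one (hp : IsQFunction (qStar b c) p) (hb : IsRateSequence b)
    (hc : 1 ≤ c) {k : ℕ} (hk : 1 ≤ k) (hd : genBiDerivOne b c ≤ 0) :
    b 0 * occupationTime p k 1 = 1 := by
  refine (hp.absorbed_le_one hb hc hk).antisymm ?_
  have h := ((continuous_occupationNumerator (b := b) (c := c) k (b 0 * occupationTime p k 1)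
    (occupationTime p k)).tendsto 1).mono_left (nhdsWithin_le_nhds (s := Iio 1))
  have h0 := ge_of_tendsto (b := (0 : ℝ)) h <| by
    filter_upwards [Ioo_mem_nhdsLT (zero_lt_one' ℝ)] with s hs
    have hs' := Ioo_subset_Ico_self hs
    simpa using hp.genBi_mul_sum_le hb hc hk hs' (genBi_pos hb hd hs').le 0
  simp only [occupationNumerator, one_pow, sub_self, zero_mul, add_zero] at h0
  linarith

theorem extinctionSystem (hp : IsQFunction (qStar b c) p) (hb : IsRateSequence b)
    (hc : 1 ≤ c) {k : ℕ} (hk : 1 ≤ k) {u : ℝ}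
    (hu : IsLeast {s | s ∈ Icc (0 : ℝ) 1 ∧ genBi b c s = 0} u) :
    ExtinctionSystem b c k u (b 0 * occupationTime p k 1) (occupationTime p k) where
  root := by
    have h0 : occupationNumerator b c k (b 0 * occupationTime p k 1) (occupationTime p k) u = 0 := by
      -- If `u = 1` the numerator identity, proved only for `s < 1`, is unavailable. But then the
      -- derivative is `≤ 0`, and the equation reduces to `e = 1`.
      rcases hu.1.1.2.eq_or_lt with h1 | hlt
      · have hd : genBiDerivOne b c ≤ 0 := by
          by_contra! hd
          obtain ⟨s, hs, hs0⟩ := exists_root_lt_one hb hd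
          exact absurd (hu.2 ⟨Ico_subset_Icc_self hs, hs0⟩) (not_le.2 (h1 ▸ hs.2))
        simp [occupationNumerator, hp.absorbed_eq_one hb hc hk hd, h1]
      · exact hp.occupationNumerator_eq_zero hb hc hk ⟨hu.1.1.1, hlt⟩ hu.1.2
    unfold occupationNumerator at h0
    have : ∑ i ∈ Finset.Icc 1 (c - 1),
        occupationTime p k i * u ^ (i - 1) * ((c : ℝ) - (i : ℝ)) * b 0 * (1 - u) =
        (1 - u) * b 0 * ∑ i ∈ Finset.Icc 1 (c - 1),
          occupationTime p k i * u ^ (i - 1) * ((c : ℝ) - i) := by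
      rw [Finset.mul_sum]
      exact Finset.sum_congr rfl fun i _ => by ring
    rw [this]
    linarith
  absorb _ := rfl
  balance j hj hjc := by
    have h := (hp.occupationRecursion hb hc k).balance j hj
    rw [Nat.min_eq_left (by omega), Nat.min_eq_left (by omega)] at h
    push_cast at h
    exact h

/-- The sum subtracted in the root equation is nonnegative, so `e ≤ u^k < 1`. -/
theorem absorbed_lt_one (hp : IsQFunction (qStar b c) p) (hb : IsRateSequence b)
    (hc : 1 ≤ c) {k : ℕ} (hk : 1 ≤ k) (hd : 0 < genBiDerivOne b c) :
    b 0 * occupationTime p k 1 < 1 := by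
  obtain ⟨u, hu⟩ := exists_isLeast_root hb c
  obtain ⟨s, hs, hs0⟩ := exists_root_lt_one hb hd
  have hu1 : u < 1 := (hu.2 ⟨Ico_subset_Icc_self hs, hs0⟩).trans_lt hs.2
  have h := (hp.extinctionSystem hb hc hk hu).root
  have hsum : 0 ≤ ∑ i ∈ Finset.Icc 1 (c - 1),
      occupationTime p k i * u ^ (i - 1) * ((c : ℝ) - (i : ℝ)) * b 0 * (1 - u) := by
    refine Finset.sum_nonneg fun i hi => ?_
    rw [Finset.mem_Icc] at hi
    have hic : (i : ℝ) ≤ c := by exact_mod_cast (by omega : i ≤ c)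
    exact mul_nonneg (mul_nonneg (mul_nonneg (mul_nonneg (hp.occupationTime_nonneg k i)
      (pow_nonneg hu.1.1.1 _)) (sub_nonneg.2 hic)) hb.zero_pos.le) (sub_nonneg.2 hu1.le)
  have hpow : u ^ k < 1 := pow_lt_one₀ hu.1.1.1 hu1 (by omega)
  linarith

/-- The limit at `s = 1` of `B_c(s) ∑ m_i s^(i-1) / (1 - s)`. -/
theorem tendsto_neg_slope_mul (hp : IsQFunction (qStar b c) p) (hb : IsRateSequence b)
    (hc : 1 ≤ c) {k : ℕ} (hk : 1 ≤ k) (hd : genBiDerivOne b c ≤ 0) :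
    Tendsto (fun s => -slope (genBi b c) 1 s * ∑' i, occupationTime p k (i + 1) * s ^ i)
      (𝓝[<] 1) (𝓝 ((k : ℝ) + ∑ i ∈ Finset.Icc 1 (c - 1),
        occupationTime p k i * ((c : ℝ) - (i : ℝ)) * b 0)) := by
  have hcont : Continuous fun s : ℝ => ∑ l ∈ Finset.range k, s ^ l + b 0 *
      ∑ i ∈ Finset.Icc 1 (c - 1), occupationTime p k i * s ^ (i - 1) * ((c : ℝ) - i) := by
    fun_prop
  have hlim := (hcont.tendsto 1).mono_left (nhdsWithin_le_nhds (s := Iio 1))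
  have hval : ∑ l ∈ Finset.range k, (1 : ℝ) ^ l + b 0 *
      ∑ i ∈ Finset.Icc 1 (c - 1), occupationTime p k i * 1 ^ (i - 1) * ((c : ℝ) - i) =
      (k : ℝ) + ∑ i ∈ Finset.Icc 1 (c - 1),
        occupationTime p k i * ((c : ℝ) - (i : ℝ)) * b 0 := by
    rw [Finset.mul_sum]
    simp only [one_pow, mul_one, Finset.sum_const, Finset.card_range, nsmul_eq_mul]
    congr 1
    exact Finset.sum_congr rfl fun i _ => by ring
  rw [hval] at hlim
  refine hlim.congr' ?_
  filter_upwards [Ioo_mem_nhdsLT (zero_lt_one' ℝ)] with s hs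
  have hs' := Ioo_subset_Ico_self hs
  have h := hp.genBi_mul_tsum hb hc hk hs' (genBi_pos hb hd hs')
  rw [occupationNumerator, hp.absorbed_eq_one hb hc hk hd] at h
  have hg := geom_sum_mul s k
  have hne : s - 1 ≠ 0 := by linarith [hs.2]
  have h1 : -slope (genBi b c) 1 s * ∑' i, occupationTime p k (i + 1) * s ^ i =
      -(genBi b c s * ∑' i, occupationTime p k (i + 1) * s ^ i) / (s - 1) := by
    rw [hb.slope_genBi]
    ring
  rw [h1, h, eq_div_iff hne]
  linear_combination hg

theorem tendsto_slope_toReal (hb : IsRateSequence b) (hd : genBiDerivOne b c ≤ 0) :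
    Tendsto (slope (genBi b c) 1) (𝓝[<] 1) (𝓝 (genBiDerivOne b c).toReal) := by
  have htop : genBiDerivOne b c ≠ ⊤ := (hd.trans_lt EReal.zero_lt_top).ne
  exact (EReal.tendsto_toReal htop (genBiDerivOne_ne_bot c)).comp (tendsto_slope_genBi hb c)

theorem tsum_mul_pow_le (hp : IsQFunction (qStar b c) p) {k : ℕ}
    (hS : Summable fun i => occupationTime p k (i + 1)) {s : ℝ} (hs : s ∈ Ico (0 : ℝ) 1) :
    ∑' i, occupationTime p k (i + 1) * s ^ i ≤ ∑' i, occupationTime p k (i + 1) := by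
  have hle : ∀ i, occupationTime p k (i + 1) * s ^ i ≤ occupationTime p k (i + 1) := fun i =>
    mul_le_of_le_one_right (hp.occupationTime_nonneg k _) (pow_le_one₀ hs.1 hs.2.le)
  exact (Summable.of_nonneg_of_le (fun i => mul_nonneg (hp.occupationTime_nonneg k _)
    (pow_nonneg hs.1 i)) hle hS).tsum_le_tsum hle hS

/-- The slope has a nonzero limit, so it can be divided out and the power series converges as `s →
1`. Its coefficients are nonnegative, so this Abel limit is the sum itself: it bounds all partial
sums and is bounded by the full series. -/
theorem hasSum_occupationTime (hp : IsQFunction (qStar b c) p) (hb : IsRateSequence b)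
    (hc : 1 ≤ c) {k : ℕ} (hk : 1 ≤ k) (hd : genBiDerivOne b c < 0) :
    HasSum (fun i => occupationTime p k (i + 1)) (-(1 / (genBiDerivOne b c).toReal) *
      ((k : ℝ) + ∑ i ∈ Finset.Icc 1 (c - 1),
        occupationTime p k i * ((c : ℝ) - (i : ℝ)) * b 0)) := by
  have hD : (genBiDerivOne b c).toReal < 0 := by
    have h := EReal.coe_toReal (hd.trans EReal.zero_lt_top).ne (genBiDerivOne_ne_bot c)
    rw [← h] at hd
    exact_mod_cast hd
  set D := (genBiDerivOne b c).toReal with hDdef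
  set V := (k : ℝ) + ∑ i ∈ Finset.Icc 1 (c - 1),
        occupationTime p k i * ((c : ℝ) - (i : ℝ)) * b 0
  have hsl := tendsto_slope_toReal hb hd.le
  have hG : Tendsto (fun s => ∑' i, occupationTime p k (i + 1) * s ^ i) (𝓝[<] 1)
      (𝓝 (-(1 / D) * V)) := by
    have h := (hsl.neg.inv₀ (neg_ne_zero.2 hD.ne)).mul
      (hp.tendsto_neg_slope_mul hb hc hk hd.le)
    rw [show (-D)⁻¹ * V = -(1 / D) * V by rw [inv_neg, one_div]] at h
    refine h.congr' ?_
    filter_upwards [hsl.eventually (gt_mem_nhds hD)] with s hs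
    rw [inv_mul_cancel_left₀ (neg_ne_zero.2 hs.ne)]
  have hpart : ∀ N, ∑ i ∈ Finset.range N, occupationTime p k (i + 1) ≤ -(1 / D) * V := by
    intro N
    have hcont : Continuous fun s : ℝ => ∑ i ∈ Finset.range N, occupationTime p k (i + 1) * s ^ i :=
      by fun_prop
    have h1 := (hcont.tendsto 1).mono_left (nhdsWithin_le_nhds (s := Iio 1))
    simp only [one_pow, mul_one] at h1
    refine le_of_tendsto_of_tendsto h1 hG ?_
    filter_upwards [Ioo_mem_nhdsLT (zero_lt_one' ℝ)] with s hs
    have hs' := Ioo_subset_Ico_self hs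
    exact (hp.summable_occupationTime_mul_pow hb hc hk hs' (genBi_pos hb hd.le hs')).sum_le_tsum _
      fun i _ => mul_nonneg (hp.occupationTime_nonneg k _) (pow_nonneg hs'.1 i)
  have hnn : ∀ i, 0 ≤ occupationTime p k (i + 1) := fun i => hp.occupationTime_nonneg k _
  have hS : Summable fun i => occupationTime p k (i + 1) := summable_of_sum_range_le hnn hpart
  have hle : ∑' i, occupationTime p k (i + 1) ≤ -(1 / D) * V :=
    Real.tsum_le_of_sum_range_le hnn hpart
  have hge : -(1 / D) * V ≤ ∑' i, occupationTime p k (i + 1) := by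
    refine le_of_tendsto hG ?_
    filter_upwards [Ioo_mem_nhdsLT (zero_lt_one' ℝ)] with s hs
    exact hp.tsum_mul_pow_le hS (Ioo_subset_Ico_self hs)
  rw [← hle.antisymm hge]
  exact hS.hasSum

/-- A finite sum would bound the power series, and its product with a slope tending to `0` would
vanish; the limit of that product is at least `k ≥ 1`. -/
theorem not_summable_occupationTime (hp : IsQFunction (qStar b c) p) (hb : IsRateSequence b)
    (hc : 1 ≤ c) {k : ℕ} (hk : 1 ≤ k) (hd : genBiDerivOne b c = 0) :
    ¬ Summable fun i => occupationTime p k (i + 1) := by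
  intro hS
  have hsl := tendsto_slope_toReal hb hd.le
  rw [hd, EReal.toReal_zero] at hsl
  have h1 := hp.tendsto_neg_slope_mul hb hc hk hd.le
  have h2 := hsl.neg.mul_const (∑' i, occupationTime p k (i + 1))
  rw [neg_zero, zero_mul] at h2
  have h3 := le_of_tendsto_of_tendsto h1 h2 <| by
    filter_upwards [Ioo_mem_nhdsLT (zero_lt_one' ℝ)] with s hs
    have hs' := Ioo_subset_Ico_self hs
    refine mul_le_mul_of_nonneg_left (hp.tsum_mul_pow_le hS hs') ?_
    rw [hb.slope_genBi, ← div_neg]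
    exact div_nonneg (genBi_pos hb hd.le hs').le (by linarith [hs.2])
  have h4 : 0 ≤ ∑ i ∈ Finset.Icc 1 (c - 1),
      occupationTime p k i * ((c : ℝ) - (i : ℝ)) * b 0 := by
    refine Finset.sum_nonneg fun i hi => ?_
    rw [Finset.mem_Icc] at hi
    have hic : (i : ℝ) ≤ c := by exact_mod_cast (by omega : i ≤ c)
    exact mul_nonneg (mul_nonneg (hp.occupationTime_nonneg k i) (sub_nonneg.2 hic)) hb.zero_pos.le
  have hk' : (1 : ℝ) ≤ k := by exact_mod_cast hk
  linarith

end IsQFunction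

end Roots

/-! ### The extinction time of the Markov chain -/

section Paths

variable {Ω : Type*} {X : ℝ≥0 → Ω → ℕ}

theorem extinctionTime_lt_iff {ω : Ω} {a : ℝ≥0∞} :
    extinctionTime X ω < a ↔ ∃ t : ℝ≥0, (0 < t ∧ X t ω = 0) ∧ (t : ℝ≥0∞) < a := by
  simp only [extinctionTime, iInf_lt_iff, exists_prop]

theorem extinctionTime_le {ω : Ω} {t : ℝ≥0} (ht : 0 < t) (h : X t ω = 0) :
    extinctionTime X ω ≤ t :=
  iInf₂_le t ⟨ht, h⟩

theorem eq_zero_of_extinctionTime_lt {ω : Ω} (hω : ∀ s t, s ≤ t → X s ω = 0 → X t ω = 0)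
    {t : ℝ≥0} (h : extinctionTime X ω < t) : X t ω = 0 := by
  obtain ⟨s, hs, hst⟩ := extinctionTime_lt_iff.1 h
  exact hω s t (by exact_mod_cast hst.le) hs.2

/-- For an absorbed path a countable dense set of times suffices, which makes the extinction time
almost everywhere measurable. -/
theorem extinctionTime_eq_iInf_denseSeq {ω : Ω} (hω : ∀ s t, s ≤ t → X s ω = 0 → X t ω = 0) :
    extinctionTime X ω = ⨅ n : ℕ, if 0 < TopologicalSpace.denseSeq ℝ≥0 n ∧
      X (TopologicalSpace.denseSeq ℝ≥0 n) ω = 0 then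
        (TopologicalSpace.denseSeq ℝ≥0 n : ℝ≥0∞) else ∞ := by
  refine le_antisymm (le_iInf fun n => ?_) (le_of_not_gt fun hlt => ?_)
  · split_ifs with h
    exacts [extinctionTime_le h.1 h.2, le_top]
  · obtain ⟨s, hs, hlt⟩ := extinctionTime_lt_iff.1 hlt
    obtain ⟨t, hst, ht⟩ := ENNReal.lt_iff_exists_nnreal_btwn.1 hlt
    obtain ⟨n, hn⟩ := (TopologicalSpace.denseRange_denseSeq ℝ≥0).exists_mem_open
      isOpen_Ioo (nonempty_Ioo.2 (ENNReal.coe_lt_coe.1 hst))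
    refine absurd (ht.trans_le (iInf_le _ n)) (not_lt.2 ?_)
    rw [if_pos ⟨hs.1.trans hn.1, hω _ _ hn.1.le hs.2⟩]
    exact_mod_cast hn.2.le

end Paths

section Chain

variable {b : ℕ → ℝ} {c : ℕ} {p : ℝ → ℕ → ℕ → ℝ}
  {Ω : Type*} [MeasurableSpace Ω] {P : Measure Ω} {X : ℝ≥0 → Ω → ℕ} {k : ℕ}

theorem IsMarkovChain.measurableSet_eq (hX : IsMarkovChain p X P) (t : ℝ≥0) (j : ℕ) :
    MeasurableSet {ω | X t ω = j} :=
  hX.measurable t (measurableSet_singleton j)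

theorem IsMarkovChain.cond_eq [IsFiniteMeasure P] (hX : IsMarkovChain p X P)
    (hPk : P {ω | X 0 ω = k} ≠ 0) (t : ℝ≥0) (j : ℕ) :
    P[|{ω | X 0 ω = k}] {ω | X t ω = j} = ENNReal.ofReal (p t k j) := by
  have h := hX.law 1 (fun l => if l = 0 then 0 else t)
    (fun l m hlm => by
      rcases Nat.eq_zero_or_pos l with rfl | hl
      · simp
      · simp [hl.ne', show m ≠ 0 by omega]) rfl (fun l => if l = 0 then k else j)
  have hset : {ω | ∀ l ≤ 1, X (if l = 0 then 0 else t) ω = if l = 0 then k else j} =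
      {ω | X 0 ω = k} ∩ {ω | X t ω = j} := by
    ext ω
    simp [Nat.le_one_iff_eq_zero_or_eq_one]
  rw [hset] at h
  rw [cond_apply (hX.measurableSet_eq 0 k), h]
  simp [← mul_assoc, ENNReal.inv_mul_cancel hPk (measure_ne_top _ _)]

theorem IsQFunction.zero_row (hp : IsQFunction (qStar b c) p) {t : ℝ} (ht : 0 ≤ t) {j : ℕ}
    (hj : j ≠ 0) : p t 0 j = 0 := by
  have h1 := hp.exp_le_diag 0 ht
  rw [qStar_zero_left, zero_mul, Real.exp_zero] at h1
  have h2 := hp.le_one_sub_diag ht hj.symm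
  exact le_antisymm (by linarith) (hp.nonneg t ht 0 j)

/-- `law` prescribes the value at time `0`, so the exceptional event is split over the countably
many values of `X_0` and `X_t`; each piece carries a factor `p_{0j} = 0`. -/
theorem IsMarkovChain.ae_absorbed_pair (hX : IsMarkovChain p X P)
    (hp : IsQFunction (qStar b c) p) {s t : ℝ≥0} (hst : s ≤ t) :
    ∀ᵐ ω ∂P, X s ω = 0 → X t ω = 0 := by
  have hnull : ∀ x j : ℕ, ∀ᵐ ω ∂P, ¬ (j ≠ 0 ∧ X 0 ω = x ∧ X s ω = 0 ∧ X t ω = j) := by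
    intro x j
    by_cases hj : j = 0
    · simp [hj]
    have h := hX.law 2 (fun l => if l = 0 then 0 else if l = 1 then s else t)
      (monotone_nat_of_le_succ fun l => by
        rcases l with _ | _ | l <;> simp [hst]) rfl
      (fun l => if l = 0 then x else if l = 1 then 0 else j)
    have hz : p ((t : ℝ) - s) 0 j = 0 := hp.zero_row (sub_nonneg.2 (by exact_mod_cast hst)) hj
    rw [Finset.prod_range_succ] at h
    simp [hz] at h
    refine measure_mono_null (fun ω hω => ?_) h
    simp only [mem_compl_iff, mem_ofPred_eq, not_not] at hω
    intro l hl
    interval_cases l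
    exacts [hω.2.1, hω.2.2.1, hω.2.2.2]
  filter_upwards [ae_all_iff.2 fun x => ae_all_iff.2 (hnull x)] with ω hω hs
  by_contra ht
  exact hω (X 0 ω) (X t ω) ⟨ht, rfl, hs, rfl⟩

/-- Almost surely, the chain stays in `0` once it is there. -/
theorem IsMarkovChain.ae_absorbed (hX : IsMarkovChain p X P)
    (hp : IsQFunction (qStar b c) p) :
    ∀ᵐ ω ∂P, ∀ s t, s ≤ t → X s ω = 0 → X t ω = 0 := by
  set d := TopologicalSpace.denseSeq ℝ≥0
  have hd : ∀ n m, ∀ᵐ ω ∂P, d n ≤ d m → X (d n) ω = 0 → X (d m) ω = 0 := fun n m => by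
    by_cases h : d n ≤ d m
    · filter_upwards [hX.ae_absorbed_pair hp h] with ω hω _ using hω
    · exact Eventually.of_forall fun ω h' => absurd h' h
  filter_upwards [hX.rightCts, ae_all_iff.2 fun n => ae_all_iff.2 (hd n)] with ω hr hω s t hst hs
  rcases hst.eq_or_lt with rfl | hlt
  · exact hs
  -- by right continuity, `X` takes the value `X r` at dense times just after `r`
  have key : ∀ r r' : ℝ≥0, r < r' → ∃ n, r < d n ∧ d n < r' ∧ X (d n) ω = X r ω := by
    intro r r' hrr'
    have h1 : ∀ᶠ x in 𝓝[≥] r, X x ω = X r ω :=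
      (hr r).eventually (p := fun y => y = X r ω) (by
        rw [nhds_discrete]; exact eventually_pure.2 rfl)
    obtain ⟨u, hu, hsub⟩ := (mem_nhdsGE_iff_exists_Ico_subset' hrr').1 h1
    obtain ⟨n, hn1, hn2⟩ := (TopologicalSpace.denseRange_denseSeq ℝ≥0).exists_mem_open
      isOpen_Ioo (nonempty_Ioo.2 (lt_min (mem_Ioi.1 hu) hrr'))
    exact ⟨n, hn1, hn2.trans_le (min_le_right _ _), hsub ⟨hn1.le, hn2.trans_le (min_le_left _ _)⟩⟩
  -- A dense time in `(s, t)` carries the value `X_s = 0` and one after `t` carries `X_t`, so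
  -- absorption along the dense set applies to the pair.
  obtain ⟨n, _, hn2, hn3⟩ := key s t hlt
  obtain ⟨m, hm1, _, hm3⟩ := key t (t + 1) (lt_add_one t)
  rw [← hm3]
  exact hω n m (hn2.trans hm1).le (hn3.trans hs)

theorem IsMarkovChain.aemeasurable_extinctionTime (hX : IsMarkovChain p X P)
    (hp : IsQFunction (qStar b c) p) : AEMeasurable (extinctionTime X) P := by
  refine ⟨fun ω => ⨅ n : ℕ, if 0 < TopologicalSpace.denseSeq ℝ≥0 n ∧
      X (TopologicalSpace.denseSeq ℝ≥0 n) ω = 0 then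
        (TopologicalSpace.denseSeq ℝ≥0 n : ℝ≥0∞) else ∞, ?_, ?_⟩
  · refine Measurable.iInf fun n => Measurable.ite ?_ measurable_const measurable_const
    exact (MeasurableSet.const _).inter (hX.measurableSet_eq _ 0)
  · filter_upwards [hX.ae_absorbed hp] with ω hω using extinctionTime_eq_iInf_denseSeq hω

/-- Up to null sets `{τ < n} ⊆ {X_n = 0} ⊆ {τ < ∞}` for `n > 0`, and the outer probabilities agree
in the limit. -/
theorem IsMarkovChain.cond_extinctionTime_lt_top [IsFiniteMeasure P] (hX : IsMarkovChain p X P)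
    (hp : IsQFunction (qStar b c) p) (hb : IsRateSequence b) (hc : 1 ≤ c) (hk : 1 ≤ k)
    (hPk : P {ω | X 0 ω = k} ≠ 0) :
    P[|{ω | X 0 ω = k}] {ω | extinctionTime X ω < ∞} =
      ENNReal.ofReal (b 0 * occupationTime p k 1) := by
  set μ := P[|{ω | X 0 ω = k}] with hμ
  have habs : ∀ᵐ ω ∂μ, ∀ s t, s ≤ t → X s ω = 0 → X t ω = 0 :=
    cond_absolutelyContinuous.ae_le (hX.ae_absorbed hp)
  have hlim : Tendsto (fun n : ℕ => μ {ω | extinctionTime X ω < (n : ℝ≥0∞)}) atTop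
      (𝓝 (μ {ω | extinctionTime X ω < ∞})) := by
    have hU : {ω | extinctionTime X ω < ∞} = ⋃ n : ℕ, {ω | extinctionTime X ω < (n : ℝ≥0∞)} := by
      ext ω
      simp only [mem_ofPred_eq, mem_iUnion]
      exact ⟨fun h => ENNReal.exists_nat_gt h.ne, fun ⟨n, hn⟩ => hn.trans (ENNReal.natCast_lt_top n)⟩
    rw [hU]
    exact tendsto_measure_iUnion_atTop fun n m hnm ω (hω : extinctionTime X ω < n) =>
      hω.trans_le (show (n : ℝ≥0∞) ≤ m by exact_mod_cast hnm)
  have hp0 : Tendsto (fun n : ℕ => μ {ω | X (n : ℝ≥0) ω = 0}) atTop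
      (𝓝 (ENNReal.ofReal (b 0 * occupationTime p k 1))) := by
    have h := ENNReal.tendsto_ofReal
      ((hp.tendsto_absorbed hb hc hk).comp tendsto_natCast_atTop_atTop)
    refine h.congr fun n => ?_
    rw [hμ, hX.cond_eq hPk]
    simp
  refine le_antisymm (le_of_tendsto_of_tendsto' hlim hp0 fun n => ?_)
    (le_of_tendsto hp0 ?_)
  · refine measure_mono_ae ?_
    filter_upwards [habs] with ω hω (h : _ < _)
    exact eq_zero_of_extinctionTime_lt hω (by simpa using h)
  · filter_upwards [eventually_gt_atTop 0] with n hn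
    refine measure_mono fun ω hω => ?_
    exact (extinctionTime_le (by exact_mod_cast hn) hω).trans_lt ENNReal.coe_lt_top

theorem IsMarkovChain.cond_ne_zero [IsFiniteMeasure P] (hX : IsMarkovChain p X P)
    (hPk : P {ω | X 0 ω = k} ≠ 0) (t : ℝ≥0) :
    P[|{ω | X 0 ω = k}] {ω | X t ω ≠ 0} = ∑' i, ENNReal.ofReal (p t k (i + 1)) := by
  have hU : {ω | X t ω ≠ 0} = ⋃ i : ℕ, {ω | X t ω = i + 1} := by
    ext ω
    simp only [mem_ofPred_eq, mem_iUnion]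
    exact ⟨fun h => ⟨X t ω - 1, by omega⟩, fun ⟨i, hi⟩ => by omega⟩
  rw [hU, measure_iUnion (fun i j hij => Set.disjoint_left.2 fun ω hi hj => hij (by
    simp only [mem_ofPred_eq] at hi hj; omega)) fun i => hX.measurableSet_eq t (i + 1)]
  exact tsum_congr fun i => hX.cond_eq hPk t (i + 1)

/-- The layer cake formula, with Tonelli over the states. Since `{τ > t} ⊆ {X_t ≠ 0} ⊆ {τ ≥ t}`
almost surely, its strict and weak forms give the two inequalities. Finiteness is essential, as
`toReal` sends `∞` to `0`. -/
theorem IsMarkovChain.meanExtinctionTime_eq_tsum [IsFiniteMeasure P] (hX : IsMarkovChain p X P)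
    (hp : IsQFunction (qStar b c) p) (hb : IsRateSequence b) (hc : 1 ≤ c)
    (hPk : P {ω | X 0 ω = k} ≠ 0)
    (hfin : ∀ᵐ ω ∂(P[|{ω | X 0 ω = k}]), extinctionTime X ω < ∞) :
    meanExtinctionTime X P k = ∑' i, ENNReal.ofReal (occupationTime p k (i + 1)) := by
  unfold meanExtinctionTime
  set μ := P[|{ω | X 0 ω = k}] with hμ
  have habs : ∀ᵐ ω ∂μ, ∀ s t, s ≤ t → X s ω = 0 → X t ω = 0 :=
    cond_absolutelyContinuous.ae_le (hX.ae_absorbed hp)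
  have hmeas : AEMeasurable (fun ω => (extinctionTime X ω).toReal) μ :=
    ((hX.aemeasurable_extinctionTime hp).mono_ac cond_absolutelyContinuous).ennreal_toReal
  have hnn : 0 ≤ᵐ[μ] fun ω => (extinctionTime X ω).toReal :=
    Eventually.of_forall fun _ => ENNReal.toReal_nonneg
  have hint : ∫⁻ ω, extinctionTime X ω ∂μ =
      ∫⁻ ω, ENNReal.ofReal (extinctionTime X ω).toReal ∂μ := by
    refine lintegral_congr_ae ?_
    filter_upwards [hfin] with ω hω
    rw [ENNReal.ofReal_toReal hω.ne]
  have hsurv : ∫⁻ t in Ioi (0 : ℝ), μ {ω | X t.toNNReal ω ≠ 0} =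
      ∑' i, ENNReal.ofReal (occupationTime p k (i + 1)) := by
    have h1 : ∫⁻ t in Ioi (0 : ℝ), μ {ω | X t.toNNReal ω ≠ 0} =
        ∫⁻ t in Ioi (0 : ℝ), ∑' i, ENNReal.ofReal (p t k (i + 1)) := by
      refine setLIntegral_congr_fun measurableSet_Ioi fun t ht => ?_
      simp only [hμ]
      rw [hX.cond_ne_zero hPk, Real.coe_toNNReal t (le_of_lt ht)]
    rw [h1, lintegral_tsum fun i =>
      (hp.integrableOn hb hc k (Nat.le_add_left 1 i)).aestronglyMeasurable.aemeasurable.ennreal_ofReal]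
    refine tsum_congr fun i => ?_
    rw [occupationTime, ofReal_integral_eq_lintegral_ofReal
      (hp.integrableOn hb hc k (Nat.le_add_left 1 i))]
    filter_upwards [ae_restrict_mem measurableSet_Ioi] with t ht
    exact hp.nonneg t (le_of_lt ht) k _
  rw [← hsurv, hint]
  refine le_antisymm ?_ ?_
  · rw [lintegral_eq_lintegral_meas_lt μ hnn hmeas]
    refine setLIntegral_mono' measurableSet_Ioi fun t ht => measure_mono fun ω hω h0 => ?_
    have h1 := extinctionTime_le (Real.toNNReal_pos.2 ht) h0
    have h2 := ENNReal.toReal_mono ENNReal.coe_ne_top h1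
    rw [ENNReal.coe_toReal, Real.coe_toNNReal t (le_of_lt ht)] at h2
    exact absurd hω (not_lt.2 h2)
  · rw [lintegral_eq_lintegral_meas_le μ hnn hmeas]
    refine setLIntegral_mono' measurableSet_Ioi fun t ht => measure_mono_ae ?_
    filter_upwards [habs, hfin] with ω hω hf (h0 : X t.toNNReal ω ≠ 0)
    have h1 : (t.toNNReal : ℝ≥0∞) ≤ extinctionTime X ω :=
      le_of_not_gt fun h => h0 (eq_zero_of_extinctionTime_lt hω h)
    have h2 := ENNReal.toReal_mono hf.ne h1
    rwa [ENNReal.coe_toReal, Real.coe_toNNReal t (le_of_lt ht)] at h2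

theorem IsMarkovChain.extinctionProb_eq [IsFiniteMeasure P] (hX : IsMarkovChain p X P)
    (hp : IsQFunction (qStar b c) p) (hb : IsRateSequence b) (hc : 1 ≤ c) (hk : 1 ≤ k)
    (hPk : P {ω | X 0 ω = k} ≠ 0) :
    extinctionProb X P k = b 0 * occupationTime p k 1 := by
  rw [extinctionProb, hX.cond_extinctionTime_lt_top hp hb hc hk hPk,
    ENNReal.toReal_ofReal (mul_nonneg hb.zero_pos.le (hp.occupationTime_nonneg k 1))]

theorem IsMarkovChain.nullMeasurableSet_extinctionTime_lt_top (hX : IsMarkovChain p X P)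
    (hp : IsQFunction (qStar b c) p) (k : ℕ) :
    NullMeasurableSet {ω | extinctionTime X ω < ∞} (P[|{ω | X 0 ω = k}]) :=
  ((hX.aemeasurable_extinctionTime hp).mono_ac cond_absolutelyContinuous).nullMeasurable
    measurableSet_Iio

theorem IsMarkovChain.meanExtinctionTime_eq_tsum_of_nonpos [IsFiniteMeasure P]
    (hX : IsMarkovChain p X P)
    (hp : IsQFunction (qStar b c) p) (hb : IsRateSequence b) (hc : 1 ≤ c) (hk : 1 ≤ k)
    (hPk : P {ω | X 0 ω = k} ≠ 0) (hd : genBiDerivOne b c ≤ 0) :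
    meanExtinctionTime X P k = ∑' i, ENNReal.ofReal (occupationTime p k (i + 1)) := by
  have := cond_isProbabilityMeasure (μ := P) hPk
  refine hX.meanExtinctionTime_eq_tsum hp hb hc hPk ?_
  have h := hX.cond_extinctionTime_lt_top hp hb hc hk hPk
  rw [hp.absorbed_eq_one hb hc hk hd, ENNReal.ofReal_one] at h
  exact (prob_compl_eq_zero_iff₀ (hX.nullMeasurableSet_extinctionTime_lt_top hp k)).2 h

/-- Since `e < 1`, the time is infinite with positive probability. -/
theorem IsMarkovChain.meanExtinctionTime_eq_top_of_pos [IsFiniteMeasure P]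
    (hX : IsMarkovChain p X P)
    (hp : IsQFunction (qStar b c) p) (hb : IsRateSequence b) (hc : 1 ≤ c) (hk : 1 ≤ k)
    (hPk : P {ω | X 0 ω = k} ≠ 0) (hd : 0 < genBiDerivOne b c) :
    meanExtinctionTime X P k = ∞ := by
  have := cond_isProbabilityMeasure (μ := P) hPk
  refine lintegral_eq_top_of_measure_eq_top_ne_zero
    ((hX.aemeasurable_extinctionTime hp).mono_ac cond_absolutelyContinuous) fun h0 => ?_
  have h1 : P[|{ω | X 0 ω = k}] {ω | extinctionTime X ω < ∞} = 1 := by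
    refine (prob_compl_eq_zero_iff₀ (hX.nullMeasurableSet_extinctionTime_lt_top hp k)).1 ?_
    simpa [compl_ofPred] using h0
  rw [hX.cond_extinctionTime_lt_top hp hb hc hk hPk, ENNReal.ofReal_eq_one] at h1
  exact (hp.absorbed_lt_one hb hc hk hd).ne h1

theorem IsMarkovChain.meanExtinctionTime_eq_top [IsFiniteMeasure P] (hX : IsMarkovChain p X P)
    (hp : IsQFunction (qStar b c) p) (hb : IsRateSequence b) (hc : 1 ≤ c) (hk : 1 ≤ k)
    (hPk : P {ω | X 0 ω = k} ≠ 0) (hd : 0 ≤ genBiDerivOne b c) :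
    meanExtinctionTime X P k = ∞ := by
  rcases hd.eq_or_lt with h0 | hd
  · rw [hX.meanExtinctionTime_eq_tsum_of_nonpos hp hb hc hk hPk h0.ge]
    by_contra h
    refine hp.not_summable_occupationTime hb hc hk h0.symm ?_
    exact (ENNReal.summable_toReal h).congr fun i =>
      ENNReal.toReal_ofReal (hp.occupationTime_nonneg k _)
  · exact hX.meanExtinctionTime_eq_top_of_pos hp hb hc hk hPk hd

theorem IsMarkovChain.meanExtinctionTime_of_neg [IsFiniteMeasure P] (hX : IsMarkovChain p X P)
    (hp : IsQFunction (qStar b c) p) (hb : IsRateSequence b) (hc : 1 ≤ c) (hk : 1 ≤ k)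
    (hPk : P {ω | X 0 ω = k} ≠ 0) (hd : genBiDerivOne b c < 0) :
    meanExtinctionTime X P k =
      ENNReal.ofReal (-(1 / (genBiDerivOne b c).toReal) *
        ((k : ℝ) + ∑ i ∈ Finset.Icc 1 (c - 1),
          occupationTime p k i * ((c : ℝ) - (i : ℝ)) * b 0)) := by
  have h := hp.hasSum_occupationTime hb hc hk hd
  rw [hX.meanExtinctionTime_eq_tsum_of_nonpos hp hb hc hk hPk hd.le, ← h.tsum_eq,
    ENNReal.ofReal_tsum_of_nonneg (fun i => hp.occupationTime_nonneg k _) h.summable]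

end Chain

end StoppedQueue

end

open StoppedQueue in
theorem theorem2p3 (c : ℕ) (hc : 1 ≤ c) (b : ℕ → ℝ) (hb : IsRateSequence b)
    (p : ℝ → ℕ → ℕ → ℝ) (hp : IsQFunction (qStar b c) p)
    {Ω : Type*} [MeasurableSpace Ω] (P : Measure Ω) [IsProbabilityMeasure P]
    (X : ℝ≥0 → Ω → ℕ) (hX : IsMarkovChain p X P)
    (k : ℕ) (hk : 1 ≤ k) (hPk : P {ω | X 0 ω = k} ≠ 0) :
    -- the two expressions for the extinction probability agree
    Tendsto (fun t => p t k 0) atTop (𝓝 (extinctionProb X P k)) ∧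
    -- the expected occupation times are finite
    (∀ i, 1 ≤ i → IntegrableOn (fun t => p t k i) (Ioi 0)) ∧
    -- (i)
    (genBiDerivOne b c ≤ 0 → extinctionProb X P k = 1) ∧
    -- (ii), whatever the sign of the derivative
    (∃ u : ℝ, IsLeast {s | s ∈ Icc (0 : ℝ) 1 ∧ genBi b c s = 0} u ∧
      (genBiDerivOne b c ≤ 0 → u = 1) ∧ (0 < genBiDerivOne b c → u < 1) ∧
      ExtinctionSystem b c k u (extinctionProb X P k) (occupationTime p k) ∧
      (∀ (e : ℝ) (m : ℕ → ℝ), ExtinctionSystem b c k u e m →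
        e = extinctionProb X P k ∧ ∀ i, 1 ≤ i → i ≤ c - 1 → m i = occupationTime p k i) ∧
      -- all the occupation times are determined
      OccupationRecursion b c k (extinctionProb X P k) (occupationTime p k) ∧
      (∀ m : ℕ → ℝ, OccupationRecursion b c k (extinctionProb X P k) m →
        ∀ i, 1 ≤ i → m i = occupationTime p k i)) ∧
    -- (iii)
    (genBiDerivOne b c < 0 →
      meanExtinctionTime X P k =
        ENNReal.ofReal (-(1 / (genBiDerivOne b c).toReal) *
          ((k : ℝ) + ∑ i ∈ Finset.Icc 1 (c - 1),
            occupationTime p k i * ((c : ℝ) - (i : ℝ)) * b 0))) ∧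
    (0 ≤ genBiDerivOne b c → meanExtinctionTime X P k = ∞) := by
  have he := hX.extinctionProb_eq hp hb hc hk hPk
  rw [he]
  obtain ⟨u, hu⟩ := exists_isLeast_root hb c
  have hsys := hp.extinctionSystem hb hc hk hu
  have hrec := hp.occupationRecursion hb hc k
  refine ⟨hp.tendsto_absorbed hb hc hk, fun i hi => hp.integrableOn hb hc k hi,
    hp.absorbed_eq_one hb hc hk,
    ⟨u, hu, fun hd => ?_, fun hd => ?_, hsys, fun e m h => h.unique hb hu.1.1 hsys, hrec,
      fun m h => h.unique hb hc hrec⟩,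
    hX.meanExtinctionTime_of_neg hp hb hc hk hPk, hX.meanExtinctionTime_eq_top hp hb hc hk hPk⟩
  · by_contra hne
    -- `B_c` has no zero on `[0, 1)` when its derivative at `1` is `≤ 0`.
    exact (genBi_pos hb hd ⟨hu.1.1.1, lt_of_le_of_ne hu.1.1.2 hne⟩).ne' hu.1.2
  · obtain ⟨s, hs, hs0⟩ := exists_root_lt_one hb hd
    exact (hu.2 ⟨Ico_subset_Icc_self hs, hs0⟩).trans_lt hs.2
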